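/- **Product rule.** Let $S\subset\mathbb R^d$ be the unit sphere, and let $g,h:S\to\mathbb R$ be given by multivariate power series $$g(x)=\sum_{k\ge 0}\sum_{v\in V_k}a_v\prod_{i=1}^{k}\langle\beta_{v,i},x\rangle,\qquad h(x)=\sum_{k\ge 0}\sum_{w\in W_k}b_w\prod_{i=1}^{k}\langle\gamma_{w,i},x\rangle ,$$ with auxiliary functions $\tilde g(y)=\sum_k\tilde a_ky^k$, $\tilde a_k=\sum_{v\in V_k}|a_v|\prod_{i=1}^k\|\beta_{v,i}\|_2$, and $\tilde h$ defined likewise. Assume that these sums and the power series of $\tilde g,\tilde g',\tilde h,\tilde h'$ at $y=1$ converge (here $\tilde g'(y)=\sum_k k\tilde a_ky^{k-1}$). Put $$\sqrt{M_{gh}}=\tilde g'(1)\tilde h(1)+\tilde g(1)\tilde h'(1)+\tilde g(0)\tilde h(0).$$ Then $gh$ is efficiently learnable with constant $M_{gh}$, in the following sense. Let $L(y,\hat y)$ be a measurable loss with values in $[0,B]$, with $L(y,y)=0$, and 1-Lipschitz in $\hat y$. For a (possibly randomized) learning algorithm, a function $f$ on $S$, a probability distribution $D$ on $S$ and $\epsilon>0$,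 $\delta\in(0,1)$, let $n_{f,D}(\epsilon,\delta)\in\{0,1,2,\dots,\infty\}$ be the smallest $n$ such that from $n$ i.i.d. examples of $f$ on $D$ the algorithm produces, with probability greater than $1-\delta$, a model $\hat f$ with $\mathbb E_{x\sim D}[L(f(x),\hat f(x))]<\epsilon$. Let $K(x,x')=\sum_{k\ge0}b_k\langle x,x'\rangle^k$ be a slowly decaying kernel: $\sum_k b_k<\infty$, $b_0>0$, and $b_k\ge c/k^2$ for all $k\ge1$ and some $c>0$. There is a constant $C>0$, depending only on $(b_k)_k$ and $B$ (not on $d$, $L$, $g$, $h$, their representations, $D$, $\epsilon$, $\delta$), such that $$n_{gh,D}(\epsilon,\delta)\le C\,\frac{M_{gh}+\log(1/\delta)}{\epsilon^2}$$ holds 1. for all $D,\epsilon,\delta$, when the algorithm is kernel regression with $K$, i.e. it returns the interpolant of the examples of least norm in the reproducing kernel Hilbert space of $K$; 2. when the algorithm trains a sufficiently wide one-hidden-layer network with SGD: let the hidden units be $\varphi(w,\cdot)$, jointly measurable and square-integrable in $w$, with i.i.d. random weights $w\sim\nu$ that are kept fixed and with $\mathbb E_w[\varphi(w,x)\varphi(w,x')]=K(x,x')$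 for all $x,x'\in S$; let the output of a network of width $m$ be $\frac{1}{\sqrt m}\sum_{i\le m}a_i\varphi(w_i,x)$, where the $a_i$ start at $0$ and are trained by $T$ steps of stochastic gradient descent with step size $\eta$ for the squared loss, each step at an independent uniformly chosen example. For all $D,\epsilon,\delta$ the bound holds for all sufficiently large $m$, all sufficiently small $\eta>0$ (depending on $m$), and all sufficiently large $T$ (depending on $m,\eta$). -/

import Mathlib

open MeasureTheory
open scoped BigOperators ENNReal

universe u v w

/-- The unit sphere of `ℝ^d`, the space of inputs. -/
abbrev UnitSphere (d : ℕ) : Type := Metric.sphere (0 : EuclideanSpace ℝ (Fin d)) 1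

/-! ### Multivariate power series and their auxiliary functions -/

/-- The data of a multivariate power series
`∑ k, ∑ v ∈ V k, a v * ∏ i < k, ⟪β v i, x⟫`: `V k` indexes the terms of order `k`. -/
structure MultiPowerSeries (d : ℕ) where
  V : ℕ → Type u
  a : ∀ k, V k → ℝ
  β : ∀ k, V k → Fin k → EuclideanSpace ℝ (Fin d)

namespace MultiPowerSeries

variable {d : ℕ}

/-- The sum of the power series at `x`. -/
noncomputable def sum (P : MultiPowerSeries.{u} d) (x : EuclideanSpace ℝ (Fin d)) : ℝ :=
  ∑' k, ∑' v : P.V k, P.a k v * ∏ i, inner ℝ (P.β k v i) x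

/-- The coefficient `∑ v ∈ V k, |a v| * ∏ i, ‖β v i‖` of the auxiliary function. -/
noncomputable def tildeCoeff (P : MultiPowerSeries.{u} d) (k : ℕ) : ℝ :=
  ∑' v : P.V k, |P.a k v| * ∏ i, ‖P.β k v i‖

/-- The auxiliary function, written `g̃`. -/
noncomputable def tilde (P : MultiPowerSeries.{u} d) (y : ℝ) : ℝ :=
  ∑' k, P.tildeCoeff k * y ^ k

/-- The derivative of the auxiliary function, written `g̃'`, as the termwise derivative of its power
series (so that it makes sense at `y = 1` also when the radius of convergence is exactly `1`). -/
noncomputable def tildeDeriv (P : MultiPowerSeries.{u} d) (y : ℝ) : ℝ :=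
  ∑' k : ℕ, (k : ℝ) * P.tildeCoeff k * y ^ (k - 1)

/-- `P` is a power series representation of `g` on the unit sphere, its auxiliary function is given
by a power series that converges at `1`, and so does the series of the derivative. -/
structure Represents (P : MultiPowerSeries.{u} d) (g : UnitSphere d → ℝ) : Prop where
  eq_sum : ∀ x : UnitSphere d, g x = P.sum x
  summable_terms : ∀ k, Summable fun v : P.V k => |P.a k v| * ∏ i, ‖P.β k v i‖
  summable_tilde : Summable fun k => P.tildeCoeff k * (1 : ℝ) ^ k
  summable_tildeDeriv : Summable fun k : ℕ => (k : ℝ) * P.tildeCoeff k * (1 : ℝ) ^ (k - 1)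

end MultiPowerSeries

/-! ### Learning algorithms and sample complexity -/

/-- A possibly randomized learning algorithm for real-valued functions on `X`: from `n` labelled
examples and a random seed it produces a trained model. -/
structure Learner (X : Type u) where
  Seed : ℕ → Type v
  [measurableSpaceSeed : ∀ n, MeasurableSpace (Seed n)]
  law : ∀ n, Measure (Seed n)
  [isProbabilityMeasure_law : ∀ n, IsProbabilityMeasure (law n)]
  train : ∀ n, (Fin n → X × ℝ) → Seed n → X → ℝ

attribute [instance] Learner.measurableSpaceSeed Learner.isProbabilityMeasure_law

/-- A loss function (true value first, prediction second) with values in `[0, B]` that vanishes on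
correct predictions and is 1-Lipschitz in the prediction. -/
structure IsLoss (B : ℝ) (L : ℝ → ℝ → ℝ) : Prop where
  measurable : Measurable (Function.uncurry L)
  nonneg : ∀ y z, 0 ≤ L y z
  le_bound : ∀ y z, L y z ≤ B
  self_eq_zero : ∀ y, L y y = 0
  lipschitz : ∀ y, LipschitzWith 1 (L y)

section Learning

variable {X : Type u} [MeasurableSpace X]

/-- The generalization error `E_{x ∼ D} L(g(x), ĝ(x))` of the model `ĝ`. -/
noncomputable def generalizationError (L : ℝ → ℝ → ℝ) (D : Measure X) (g ghat : X → ℝ) : ℝ≥0∞ :=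
  ∫⁻ x, ENNReal.ofReal (L (g x) (ghat x)) ∂D

/-- The probability, over `n` independent examples from `D` labelled by `g` and over the seed, that
the model trained by `A` does not have generalization error less than `ε`. -/
noncomputable def failureProb (A : Learner.{u, v} X) (L : ℝ → ℝ → ℝ) (g : X → ℝ) (D : Measure X)
    [IsProbabilityMeasure D] (ε : ℝ) (n : ℕ) : ℝ≥0∞ :=
  ((Measure.pi fun _ : Fin n => D).prod (A.law n))
    {p | ¬ generalizationError L D g (A.train n (fun i => (p.1 i, g (p.1 i))) p.2)
      < ENNReal.ofReal ε}

/-- The sample complexity `n_{g,D}(ε, δ)`: the least number of examples with which `A` has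
generalization error less than `ε` with probability greater than `1 - δ` (that is, it fails with
probability less than `δ`); it is `⊤` if there is no such number. -/
noncomputable def sampleComplexity (A : Learner.{u, v} X) (L : ℝ → ℝ → ℝ) (g : X → ℝ)
    (D : Measure X) [IsProbabilityMeasure D] (ε δ : ℝ) : ℕ∞ :=
  ⨅ (n : ℕ) (_ : failureProb A L g D ε n < ENNReal.ofReal δ), (n : ℕ∞)

/-- `n_{g,D}(ε, δ) ≤ C (M + log (1/δ)) / ε²`. -/
def SampleBound (A : Learner.{u, v} X) (L : ℝ → ℝ → ℝ) (C M : ℝ) (g : X → ℝ)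
    (D : Measure X) [IsProbabilityMeasure D] (ε δ : ℝ) : Prop :=
  (sampleComplexity A L g D ε δ : ℝ≥0∞) ≤ ENNReal.ofReal (C * (M + Real.log δ⁻¹) / ε ^ 2)

/-- `g` is efficiently learned by `A` (with respect to the constant `C`) with `M_g = M`. -/
def EfficientlyLearned (A : Learner.{u, v} X) (L : ℝ → ℝ → ℝ) (C M : ℝ) (g : X → ℝ) : Prop :=
  ∀ (D : Measure X) [IsProbabilityMeasure D] (ε δ : ℝ), 0 < ε → 0 < δ → δ < 1 →
    SampleBound A L C M g D ε δ

end Learning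

/-! ### Kernel learning -/

/-- The coefficients `b k` are those of a slowly decaying kernel: `∑ b k` converges and
`(b k)^(-1/2) = O(k)`, that is, `b k ≥ c / k²` for `k ≥ 1` (and `b 0 > 0`). -/
structure SlowlyDecaying (b : ℕ → ℝ) : Prop where
  summable : Summable b
  zero_pos : 0 < b 0
  lower : ∃ c : ℝ, 0 < c ∧ ∀ k : ℕ, 1 ≤ k → c / (k : ℝ) ^ 2 ≤ b k

/-- The kernel `K(x, x') = ∑ b k ⟪x, x'⟫ ^ k` on the unit sphere. -/
noncomputable def dotKernel {d : ℕ} (b : ℕ → ℝ) (x x' : UnitSphere d) : ℝ :=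
  ∑' k, b k * (inner ℝ (x : EuclideanSpace ℝ (Fin d)) (x' : EuclideanSpace ℝ (Fin d))) ^ k

open Classical in
/-- Kernel regression: from the data `(x i, y i)` it returns `x ↦ ∑ i, α i * K (x i) x` where
`∑ i, K (x j) (x i) * α i = y j` for all `j`. This is the interpolant of least norm in the
reproducing kernel Hilbert space of `K` (it does not depend on the choice of `α`). If there is no
such `α` it returns `0`. -/
noncomputable def kernelInterpolant {X : Type u} (K : X → X → ℝ) {n : ℕ} (data : Fin n → X × ℝ) :
    X → ℝ :=
  if h : ∃ α : Fin n → ℝ, ∀ j, ∑ i, K (data j).1 (data i).1 * α i = (data j).2 then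
    fun x => ∑ i, h.choose i * K (data i).1 x
  else 0

/-- Kernel regression as a (deterministic) learning algorithm. -/
noncomputable def kernelLearner {X : Type u} (K : X → X → ℝ) : Learner.{u, 0} X where
  Seed := fun _ => Unit
  law := fun _ => Measure.dirac ()
  train := fun _ data _ => kernelInterpolant K data

/-! ### Wide one-hidden-layer networks -/

/-- The hidden layer has independent random units `φ(w, ·)`, `w ∼ ν` (for instance
`φ(w, x) = σ(⟪w, x⟫)`), and its kernel `E_w [φ(w, x) φ(w, x')]` is `K`. -/
structure HasHiddenKernel {X : Type u} [MeasurableSpace X] {W : Type w} [MeasurableSpace W]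
    (ν : Measure W) (φ : W → X → ℝ) (K : X → X → ℝ) : Prop where
  measurable : Measurable (Function.uncurry φ)
  memLp : ∀ x, MemLp (fun ω => φ ω x) 2 ν
  kernel_eq : ∀ x x', ∫ ω, φ ω x * φ ω x' ∂ν = K x x'

/-- The activation of the `i`-th of `m` hidden units on `x`, with the usual scaling. -/
noncomputable def hiddenActivation {X : Type u} {W : Type w} (φ : W → X → ℝ) {m : ℕ}
    (ω : Fin m → W) (x : X) (i : Fin m) : ℝ :=
  φ (ω i) x / √(m : ℝ)

/-- The output of the network with hidden weights `ω` and output weights `a`. -/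
noncomputable def networkOutput {X : Type u} {W : Type w} (φ : W → X → ℝ) {m : ℕ}
    (ω : Fin m → W) (a : Fin m → ℝ) (x : X) : ℝ :=
  ∑ i, a i * hiddenActivation φ ω x i

/-- One step of stochastic gradient descent with step size `η` on the output weights, for the
squared loss `(f(x j) - y j)² / 2` at the example with index `j = ⌊n u⌋`; this index is uniformly
distributed when `u` is uniform on `[0, 1]`. -/
noncomputable def sgdStep {X : Type u} {W : Type w} (φ : W → X → ℝ) {m n : ℕ} (η : ℝ)
    (data : Fin n → X × ℝ) (ω : Fin m → W) (a : Fin m → ℝ) (r : unitInterval) : Fin m → ℝ :=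
  if h : ⌊(n : ℝ) * (r : ℝ)⌋₊ < n then
    fun i => a i - η *
      (networkOutput φ ω a (data ⟨_, h⟩).1 - (data ⟨_, h⟩).2) *
        hiddenActivation φ ω (data ⟨_, h⟩).1 i
  else a

/-- A one-hidden-layer network of width `m`: the hidden weights are drawn independently from `ν` and
kept, the output weights start at `0` and are trained by `T` steps of stochastic gradient descent
with step size `η`, each at an independent uniformly chosen example. -/
noncomputable def sgdNetwork {X : Type u} {W : Type w} [MeasurableSpace W] (ν : Measure W)
    [IsProbabilityMeasure ν] (φ : W → X → ℝ) (m : ℕ) (η : ℝ) (T : ℕ) : Learner.{u, w} X where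
  Seed := fun _ => (Fin m → W) × (Fin T → unitInterval)
  law := fun _ => (Measure.pi fun _ : Fin m => ν).prod (Measure.pi fun _ : Fin T => volume)
  train := fun _ data s =>
    networkOutput φ s.1 (Fin.foldl T (fun a t => sgdStep φ η data s.1 a (s.2 t)) 0)

/-! The kernel has the feature map `x ↦ (√(b k) x^⊗k)_k` into the Hilbert sum of the tensor powers
of `ℝ^d`. There a monomial `∏ ⟪β i, x⟫` of degree `k` is the pairing with a vector of norm `(b
k)^(-1/2) ∏ ‖β i‖`, and slow decay makes the first factor `O(k)` for `k ≥ 1`. A term of degree `k`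
of `g` times a term of degree `l` of `h` is a monomial of degree `k + l`. The weight `k + l` splits
as in the Leibniz rule into the two products with one derivative; the constant term, whose weight is
`1` instead of `0`, contributes `g̃(0) h̃(0)`. Hence `g h` is the pairing of the features with some
`θ` of norm at most `c √M` (`MultiPowerSeries.Represents.exists_vector_mul`).

Learning rests on a dimension-free uniform deviation bound for linear predictors of norm at most `R`
(`measure_exists_deviation_le`): symmetrization and contraction bound the expected supremum
(`expectedSup_inner_le`), and Hoeffding's lemma, applied one example at a time, bounds its
fluctuations (`lintegral_exp_sup_le`).

Kernel regression has no training error and norm at most `‖θ‖` (`exists_kernelInterpolant_eq`), so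
the bound applies to it. For networks, the law of large numbers makes the Gram matrices of the
hidden layer converge to the invertible Gram matrix of the kernel at the distinct examples. Wide
networks therefore have interpolants of norm at most some `R` just above `‖θ‖`
(`eventually_exists_interpolant`). Gradient descent never moves away from an interpolant
(`norm_sgdWeights_sub_le`), so its weights stay in the ball of radius `2 R`, while its residuals
tend to zero in mean square (`tendsto_lintegral_sgd_residual`). The deviation bound on this ball
does not depend on the width. -/

/-! ### Functionals that behave like an averaged supremum -/

/-- Functionals on `ι → ℝ` that share the properties of `A ↦ sup A` used in symmetrization and
contraction arguments. -/
structure IsSupLike {ι : Type*} (U : (ι → ℝ) → ℝ) : Prop where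
  mono : Monotone U
  add_const : ∀ (A : ι → ℝ) (c : ℝ), U (fun i => A i + c) = U A + c
  convex : ConvexOn ℝ Set.univ U
  -- One step of the Ledoux–Talagrand contraction principle with both signs written out, so that no
  -- Rademacher variables are needed.
  contract : ∀ A p q : ι → ℝ, (∀ i j, |p i - p j| ≤ |q i - q j|) →
    U (A + p) + U (A - p) ≤ U (A + q) + U (A - q)

namespace IsSupLike

variable {ι : Type*} {U : (ι → ℝ) → ℝ}

theorem le_add_of_le (hU : IsSupLike U) {A A' : ι → ℝ} {c : ℝ} (h : ∀ i, A i ≤ A' i + c) :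
    U A ≤ U A' + c := by
  rw [← hU.add_const]
  exact hU.mono h

theorem abs_le (hU : IsSupLike U) {A : ι → ℝ} {c : ℝ} (h : ∀ i, |A i| ≤ c) :
    |U A| ≤ |U 0| + c := by
  have h1 : U A ≤ U 0 + c := hU.le_add_of_le fun i => by
    simpa using (le_abs_self _).trans (h i)
  have h2 : U 0 ≤ U A + c := hU.le_add_of_le fun i => by
    have := (neg_abs_le (A i))
    have := h i
    simp only [Pi.zero_apply]
    linarith
  have := neg_abs_le (U 0)
  have := le_abs_self (U 0)
  rw [_root_.abs_le]
  constructor <;> linarith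

variable [Fintype ι]

theorem lipschitz (hU : IsSupLike U) : LipschitzWith 1 U := by
  refine LipschitzWith.of_le_add fun A A' => hU.le_add_of_le fun i => ?_
  have := dist_le_pi_dist A A' i
  rw [Real.dist_eq] at this
  linarith [le_abs_self (A i - A' i)]

section avg

variable {X : Type*} [MeasurableSpace X] {D : Measure X} [IsProbabilityMeasure D]

theorem measurable_comp (hU : IsSupLike U) {q : X → ι → ℝ} (hq : ∀ i, Measurable fun x => q x i) :
    Measurable fun x => U (q x) :=
  hU.lipschitz.continuous.measurable.comp (measurable_pi_lambda _ hq)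

theorem integrable_comp (hU : IsSupLike U) {q : X → ι → ℝ} {G : X → ℝ}
    (hq : ∀ i, Measurable fun x => q x i) (hG : Integrable G D) (hle : ∀ x i, |q x i| ≤ G x) :
    Integrable (fun x => U (q x)) D := by
  refine Integrable.mono' (g := fun x => |U 0| + G x) ((integrable_const _).add hG)
    (hU.measurable_comp hq).aestronglyMeasurable (Filter.Eventually.of_forall fun x => ?_)
  exact hU.abs_le (hle x)

theorem integrable_add (hU : IsSupLike U) {q : X → ι → ℝ} {B : ℝ}
    (hq : ∀ i, Measurable fun x => q x i) (hB : ∀ x i, |q x i| ≤ B) (A : ι → ℝ) :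
    Integrable (fun x => U (A + q x)) D := by
  refine hU.integrable_comp (G := fun _ => ‖A‖ + B) (fun i => ?_) (integrable_const _) fun x i => ?_
  · exact (hq i).const_add _
  · refine (abs_add_le _ _).trans (add_le_add ?_ (hB x i))
    exact norm_le_pi_norm A i

/-- All four properties are (in)equalities between values of `U` at shifted arguments, so they
survive integration. This allows induction on the number of examples. -/
theorem average (hU : IsSupLike U) {q : X → ι → ℝ} {B : ℝ} (hq : ∀ i, Measurable fun x => q x i)
    (hB : ∀ x i, |q x i| ≤ B) : IsSupLike fun A => ∫ x, U (A + q x) ∂D := by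
  have hint := fun A => hU.integrable_add (D := D) hq hB A
  refine ⟨fun A A' h => ?_, fun A c => ?_, ⟨convex_univ, fun A _ A' _ a b ha hb hab => ?_⟩,
    fun A p r h => ?_⟩
  · exact integral_mono (hint A) (hint A') fun x => hU.mono (add_le_add_left h _)
  · have : ∀ x, U ((fun i => A i + c) + q x) = U (A + q x) + c := fun x => by
      rw [← hU.add_const]
      congr 1
      ext i
      simp only [Pi.add_apply]
      ring
    simp_rw [this]
    rw [integral_add (hint A) (integrable_const _)]
    simp
  · simp only [smul_eq_mul]
    rw [← integral_const_mul, ← integral_const_mul,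
      ← integral_add ((hint A).const_mul a) ((hint A').const_mul b)]
    refine integral_mono (hint _) (((hint A).const_mul a).add ((hint A').const_mul b)) fun x => ?_
    have h1 := hU.convex.2 (Set.mem_univ (A + q x)) (Set.mem_univ (A' + q x)) ha hb hab
    have h2 : a • A + b • A' + q x = a • (A + q x) + b • (A' + q x) := by
      rw [smul_add, smul_add, add_add_add_comm, ← add_smul, hab, one_smul]
    simp only [h2]
    exact h1
  · rw [← integral_add (hint _) (hint _), ← integral_add (hint _) (hint _)]
    refine integral_mono ((hint _).add (hint _)) ((hint _).add (hint _)) fun x => ?_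
    have := hU.contract (A + q x) p r h
    have e : ∀ r : ι → ℝ, A + r + q x = A + q x + r ∧ A - r + q x = A + q x - r := fun r =>
      ⟨by abel, by abel⟩
    simpa only [(e p).1, (e p).2, (e r).1, (e r).2] using this

end avg

theorem sup' [Nonempty ι] : IsSupLike fun A : ι → ℝ => Finset.univ.sup' Finset.univ_nonempty A := by
  refine ⟨fun A A' h => ?_, fun A c => ?_, ⟨convex_univ, fun A _ A' _ a b ha hb hab => ?_⟩,
    fun A p q h => ?_⟩
  · exact Finset.sup'_mono_fun fun i _ => h i
  · refine le_antisymm (Finset.sup'_le _ _ fun i hi => ?_) ?_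
    · exact add_le_add_left (Finset.le_sup' A hi) c
    · rw [← le_sub_iff_add_le]
      refine Finset.sup'_le _ _ fun i hi => ?_
      rw [le_sub_iff_add_le]
      exact Finset.le_sup' (fun i => A i + c) hi
  · refine Finset.sup'_le _ _ fun i _ => ?_
    simp only [Pi.add_apply, Pi.smul_apply, smul_eq_mul]
    gcongr
    · exact Finset.le_sup' A (Finset.mem_univ i)
    · exact Finset.le_sup' A' (Finset.mem_univ i)
  · obtain ⟨i, -, hi⟩ := Finset.exists_mem_eq_sup' Finset.univ_nonempty (A + p)
    obtain ⟨j, -, hj⟩ := Finset.exists_mem_eq_sup' Finset.univ_nonempty (A - p)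
    rw [hi, hj]
    have key := h i j
    have e1 := Finset.le_sup' (A + q) (Finset.mem_univ i)
    have e2 := Finset.le_sup' (A + q) (Finset.mem_univ j)
    have e3 := Finset.le_sup' (A - q) (Finset.mem_univ i)
    have e4 := Finset.le_sup' (A - q) (Finset.mem_univ j)
    simp only [Pi.add_apply, Pi.sub_apply] at e1 e2 e3 e4
    change A i + p i + (A j - p j) ≤ _
    rcases abs_cases (q i - q j) with ⟨h1, -⟩ | ⟨h1, -⟩ <;>
      linarith [le_abs_self (p i - p j)]

end IsSupLike

/-! ### Concentration of the supremum of an empirical process. -/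

section UniformConvergence

variable {ι : Type*} [Fintype ι] [Nonempty ι] {X : Type*} [MeasurableSpace X] (D : Measure X)
  [IsProbabilityMeasure D]

/-- `E sup_i (A i + ∑ j < n, q (x j) i)` for independent `x j ∼ D`, as an iterated integral. -/
noncomputable def expectedSup (q : X → ι → ℝ) : ℕ → (ι → ℝ) → ℝ
  | 0, A => Finset.univ.sup' Finset.univ_nonempty A
  | n + 1, A => ∫ x, expectedSup q n (A + q x) ∂D

variable {D}

theorem isSupLike_expectedSup {q : X → ι → ℝ} {B : ℝ} (hq : ∀ i, Measurable fun x => q x i)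
    (hB : ∀ x i, |q x i| ≤ B) (n : ℕ) : IsSupLike (expectedSup D q n) := by
  induction n with
  | zero => exact IsSupLike.sup'
  | succ n ih => exact ih.average hq hB

/-- The exponential moment bound behind McDiarmid's inequality for suprema of empirical processes. -/
theorem lintegral_exp_sup_le {ℓ : X → ι → ℝ} {B : ℝ} (hℓ : ∀ i, Measurable fun x => ℓ x i)
    (h0 : ∀ x i, 0 ≤ ℓ x i) (hB : ∀ x i, ℓ x i ≤ B) (t : ℝ) (n : ℕ) (A : ι → ℝ) :
    ∫⁻ x : Fin n → X, ENNReal.ofReal (Real.exp (t * Finset.univ.sup' Finset.univ_nonempty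
        (A + ∑ j, fun i => (∫ y, ℓ y i ∂D) - ℓ (x j) i))) ∂(Measure.pi fun _ => D)
      ≤ ENNReal.ofReal (Real.exp (t * expectedSup D (fun x i => (∫ y, ℓ y i ∂D) - ℓ x i) n A
        + n * (t ^ 2 * B ^ 2 / 8))) := by
  set m : ι → ℝ := fun i => ∫ y, ℓ y i ∂D with hm
  have hint : ∀ i, Integrable (fun y => ℓ y i) D := fun i =>
    Integrable.of_mem_Icc 0 B (hℓ i).aemeasurable
      (Filter.Eventually.of_forall fun y => ⟨h0 y i, hB y i⟩)
  have hm0 : ∀ i, 0 ≤ m i := fun i => integral_nonneg fun y => h0 y i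
  have hmB : ∀ i, m i ≤ B := fun i => by
    have := integral_mono (hint i) (integrable_const B) (fun y => hB y i)
    simpa using this
  set q : X → ι → ℝ := fun x i => m i - ℓ x i with hqdef
  have hq : ∀ i, Measurable fun x => q x i := fun i => (hℓ i).const_sub _
  have hqB : ∀ x i, |q x i| ≤ B := fun x i => by
    simp only [hqdef]
    rw [abs_le]
    constructor <;> linarith [h0 x i, hB x i, hm0 i, hmB i]
  change ∫⁻ x : Fin n → X, ENNReal.ofReal (Real.exp (t * Finset.univ.sup' Finset.univ_nonempty
        (A + ∑ j, q (x j)))) ∂(Measure.pi fun _ => D)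
      ≤ ENNReal.ofReal (Real.exp (t * expectedSup D q n A + n * (t ^ 2 * B ^ 2 / 8)))
  induction n generalizing A with
  | zero => simp [expectedSup]
  | succ n ih =>
    have hU := isSupLike_expectedSup (D := D) hq hqB n
    have hmeas : Measurable fun x : X × (Fin n → X) => ENNReal.ofReal (Real.exp
        (t * Finset.univ.sup' Finset.univ_nonempty (A + q x.1 + ∑ j, q (x.2 j)))) := by
      refine ENNReal.measurable_ofReal.comp (Real.measurable_exp.comp (Measurable.const_mul ?_ _))
      refine IsSupLike.sup'.measurable_comp (q := fun x : X × (Fin n → X) =>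
        A + q x.1 + ∑ j, q (x.2 j)) fun i => ?_
      simp only [Pi.add_apply, Finset.sum_apply]
      refine (((hq i).comp measurable_fst).const_add _).add
        (Finset.measurable_sum _ fun j _ => (hq i).comp ?_)
      exact (measurable_pi_apply j).comp measurable_snd
    have hmp := measurePreserving_piFinSuccAbove (fun _ : Fin (n + 1) => D) 0
    rw [← (hmp.symm _).lintegral_comp_emb (MeasurableEquiv.measurableEmbedding _)]
    have hrw : ∀ x : X × (Fin n → X), ENNReal.ofReal (Real.exp
        (t * Finset.univ.sup' Finset.univ_nonempty (A + ∑ j, q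
          ((MeasurableEquiv.piFinSuccAbove (fun _ : Fin (n + 1) => X) 0).symm x j)))) =
        ENNReal.ofReal (Real.exp
        (t * Finset.univ.sup' Finset.univ_nonempty (A + q x.1 + ∑ j, q (x.2 j)))) := fun x => by
      rw [Fin.sum_univ_succ, add_assoc]
      simp
    simp_rw [hrw]
    rw [lintegral_prod _ hmeas.aemeasurable]
    have hUq : Measurable fun x => expectedSup D q n (A + q x) :=
      hU.measurable_comp fun i => (hq i).const_add _
    -- Since `0 ≤ ℓ ≤ B`, one example moves the value within an interval of length `B`, not `2 B`.
    -- Hoeffding's lemma then costs `t ^ 2 * B ^ 2 / 8` per example.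
    have hIcc : ∀ x, expectedSup D q n (A + q x) ∈ Set.Icc (expectedSup D q n (A + m) - B)
        (expectedSup D q n (A + m)) := fun x => by
      constructor
      · rw [sub_le_iff_le_add]
        refine hU.le_add_of_le fun i => ?_
        simp only [Pi.add_apply, hqdef]
        linarith [hB x i]
      · refine hU.mono fun i => ?_
        simp only [Pi.add_apply, hqdef]
        linarith [h0 x i]
    have hsub := ProbabilityTheory.hasSubgaussianMGF_of_mem_Icc (μ := D) hUq.aemeasurable
      (Filter.Eventually.of_forall hIcc)
    have hmgf := hsub.mgf_le t
    have hexp := hsub.integrable_exp_mul t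
    calc ∫⁻ x, ∫⁻ y : Fin n → X, ENNReal.ofReal (Real.exp
          (t * Finset.univ.sup' Finset.univ_nonempty (A + q x + ∑ j, q (y j))))
            ∂(Measure.pi fun _ => D) ∂D
        ≤ ∫⁻ x, ENNReal.ofReal (Real.exp (t * expectedSup D q n (A + q x)
            + n * (t ^ 2 * B ^ 2 / 8))) ∂D := lintegral_mono fun x => ih _
      _ = ∫⁻ x, ENNReal.ofReal (Real.exp (t * (∫ x', expectedSup D q n (A + q x') ∂D)
            + n * (t ^ 2 * B ^ 2 / 8)) * Real.exp (t * (expectedSup D q n (A + q x)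
              - ∫ x', expectedSup D q n (A + q x') ∂D))) ∂D := by
          refine lintegral_congr fun x => ?_
          rw [← Real.exp_add]
          ring_nf
      _ = ENNReal.ofReal (∫ x, Real.exp (t * (∫ x', expectedSup D q n (A + q x') ∂D)
            + n * (t ^ 2 * B ^ 2 / 8)) * Real.exp (t * (expectedSup D q n (A + q x)
              - ∫ x', expectedSup D q n (A + q x') ∂D)) ∂D) := by
          rw [ofReal_integral_eq_lintegral_ofReal (hexp.const_mul _)]
          exact Filter.Eventually.of_forall fun x => by positivity
      _ ≤ _ := by
          refine ENNReal.ofReal_le_ofReal ?_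
          rw [integral_const_mul]
          refine (mul_le_mul_of_nonneg_left hmgf (by positivity)).trans_eq ?_
          rw [← Real.exp_add]
          congr 1
          rw [expectedSup]
          push_cast
          rw [sub_sub_cancel, div_pow, Real.norm_eq_abs, sq_abs]
          ring

end UniformConvergence

/-! ### Uniform deviation bounds for linear predictors. -/

section UniformConvergence

variable {X : Type*} [MeasurableSpace X] {D : Measure X} [IsProbabilityMeasure D]
  {H : Type*} [NormedAddCommGroup H] [InnerProductSpace ℝ H]

/-- Symmetrization and contraction: the expected supremum of the empirical process of a Lipschitz
loss over linear predictors of norm at most `R`. -/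
theorem expectedSup_inner_le {ι : Type*} [Fintype ι] [Nonempty ι] {ℓ : X → ι → ℝ} {B R κ : ℝ}
    {θ : ι → H} {Ψ : X → H} (hR : ∀ i, ‖θ i‖ ≤ R)
    (hΨ : Integrable (fun x => ‖Ψ x‖ ^ 2) D) (hκ : ∫ x, ‖Ψ x‖ ^ 2 ∂D ≤ κ) (hκ0 : 0 < κ)
    (hℓ : ∀ i, Measurable fun x => ℓ x i) (h0 : ∀ x i, 0 ≤ ℓ x i) (hB : ∀ x i, ℓ x i ≤ B)
    (hlip : ∀ x i j, |ℓ x i - ℓ x j| ≤ |inner ℝ (θ i) (Ψ x) - inner ℝ (θ j) (Ψ x)|)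
    (n : ℕ) (z : H) :
    expectedSup D (fun x i => (∫ y, ℓ y i ∂D) - ℓ x i) n (fun i => inner ℝ (θ i) z)
      ≤ R * √(‖z‖ ^ 2 + 4 * n * κ) := by
  have hR0 : 0 ≤ R := (norm_nonneg _).trans (hR (Classical.arbitrary ι))
  set m : ι → ℝ := fun i => ∫ y, ℓ y i ∂D with hm
  have hint : ∀ i, Integrable (fun y => ℓ y i) D := fun i =>
    Integrable.of_mem_Icc 0 B (hℓ i).aemeasurable
      (Filter.Eventually.of_forall fun y => ⟨h0 y i, hB y i⟩)
  have hm0 : ∀ i, 0 ≤ m i := fun i => integral_nonneg fun y => h0 y i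
  have hmB : ∀ i, m i ≤ B := fun i => by
    have := integral_mono (hint i) (integrable_const B) (fun y => hB y i)
    simpa using this
  have hq : ∀ i, Measurable fun x => m i - ℓ x i := fun i => (hℓ i).const_sub _
  have hqB : ∀ x i, |m i - ℓ x i| ≤ B := fun x i => by
    rw [abs_le]
    constructor <;> linarith [h0 x i, hB x i, hm0 i, hmB i]
  -- The vector `z` stays general because each example, once contracted, adds `± 2 Ψ x` to it.
  induction n generalizing z with
  | zero =>
    simp only [expectedSup, Nat.cast_zero, mul_zero, zero_mul, add_zero, norm_nonneg,
      Real.sqrt_sq]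
    refine Finset.sup'_le _ _ fun i _ => (real_inner_le_norm _ _).trans ?_
    gcongr
    exact hR i
  | succ n ih =>
    have hU := isSupLike_expectedSup (D := D) hq hqB n
    set U := expectedSup D (fun x i => m i - ℓ x i) n with hUdef
    set A : ι → ℝ := fun i => inner ℝ (θ i) z with hA
    change ∫ x, U (A + fun i => m i - ℓ x i) ∂D ≤ _
    have hℓ2 : ∀ x i, |(2 : ℝ) • ℓ x i| ≤ 2 * B := fun x i => by
      rw [smul_eq_mul, abs_of_nonneg (by linarith [h0 x i])]
      linarith [hB x i]
    have hi1 : Integrable (fun x => U (A + (2 : ℝ) • ℓ x)) D :=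
      hU.integrable_add (q := fun x => (2 : ℝ) • ℓ x) (fun i => (hℓ i).const_smul (2 : ℝ)) hℓ2 A
    have hi2 : Integrable (fun x => U (A - (2 : ℝ) • ℓ x)) D := by
      simp_rw [sub_eq_add_neg]
      exact hU.integrable_add (q := fun x => -((2 : ℝ) • ℓ x))
        (fun i => ((hℓ i).const_smul (2 : ℝ)).neg)
        (fun x i => by simpa only [Pi.neg_apply, Pi.smul_apply, abs_neg] using hℓ2 x i) A
    have hi0 : Integrable (fun x => U (A + fun i => m i - ℓ x i)) D := hU.integrable_add hq hqB A
    -- Symmetrization: convexity separates the mean `m` from `ℓ x` at the price of a factor two, and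
    -- Jensen's inequality replaces the mean by an example. What remains is the average of `U (A ± 2
    -- ℓ x)` over both signs.
    have jensen : U (A + (2 : ℝ) • m) ≤ ∫ x, U (A + (2 : ℝ) • ℓ x) ∂D := by
      have hf : Integrable (fun x => A + (2 : ℝ) • ℓ x) D :=
        (integrable_const _).add ((Integrable.of_eval fun i => hint i).smul (2 : ℝ))
      have := hU.convex.map_integral_le (μ := D) (f := fun x => A + (2 : ℝ) • ℓ x)
        hU.lipschitz.continuous.continuousOn isClosed_univ (by simp) hf hi1
      convert this using 2
      ext i
      rw [eval_integral fun i => hf.eval i]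
      simp only [Pi.add_apply, Pi.smul_apply, smul_eq_mul]
      rw [integral_add (integrable_const _) ((hint i).const_mul _), integral_const_mul]
      simp [hm]
    have split : ∀ x, U (A + fun i => m i - ℓ x i) ≤
        1 / 2 * U (A + (2 : ℝ) • m) + 1 / 2 * U (A - (2 : ℝ) • ℓ x) := fun x => by
      have := hU.convex.2 (Set.mem_univ (A + (2 : ℝ) • m)) (Set.mem_univ (A - (2 : ℝ) • ℓ x))
        (by norm_num : (0 : ℝ) ≤ 1 / 2) (by norm_num : (0 : ℝ) ≤ 1 / 2) (by norm_num)
      have e : (A + fun i => m i - ℓ x i) =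
          (1 / 2 : ℝ) • (A + (2 : ℝ) • m) + (1 / 2 : ℝ) • (A - (2 : ℝ) • ℓ x) := by
        ext i
        simp only [Pi.add_apply, Pi.sub_apply, Pi.smul_apply, smul_eq_mul]
        ring
      rw [e]
      simpa only [smul_eq_mul] using this
    set c : ℝ := √(‖z‖ ^ 2 + 4 * ((n + 1 : ℕ) : ℝ) * κ) with hc
    have hcpos : 0 < c := Real.sqrt_pos.2 (by positivity)
    have hc2 : c ^ 2 = ‖z‖ ^ 2 + 4 * (n + 1) * κ := by
      rw [hc, Real.sq_sqrt (by positivity)]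
      push_cast
      ring
    -- The tangent to the square root at the target value `c ^ 2`. Being affine, it can be
    -- integrated over the example, and it loses nothing at the target.
    have amgm : ∀ a : ℝ, 0 ≤ a → √a ≤ (a + c ^ 2) / (2 * c) := fun a ha => by
      rw [le_div_iff₀ (by positivity)]
      nlinarith [sq_nonneg (√a - c), Real.sq_sqrt ha]
    have point : ∀ x, U (A + (2 : ℝ) • ℓ x) + U (A - (2 : ℝ) • ℓ x) ≤
        2 * (R * ((‖z‖ ^ 2 + 4 * ‖Ψ x‖ ^ 2 + 4 * n * κ + c ^ 2) / (2 * c))) := fun x => by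
      have e1 := hU.contract A ((2 : ℝ) • ℓ x) (fun i => 2 * inner ℝ (θ i) (Ψ x)) (fun i j => by
        simp only [Pi.smul_apply, smul_eq_mul, ← mul_sub, abs_mul]
        exact mul_le_mul_of_nonneg_left (hlip x i j) (abs_nonneg _))
      have e2 : (A + fun i => 2 * inner ℝ (θ i) (Ψ x)) =
          fun i => inner ℝ (θ i) (z + (2 : ℝ) • Ψ x) := by
        ext i
        simp [hA, inner_add_right, inner_smul_right]
      have e3 : (A - fun i => 2 * inner ℝ (θ i) (Ψ x)) =
          fun i => inner ℝ (θ i) (z - (2 : ℝ) • Ψ x) := by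
        ext i
        simp [hA, inner_sub_right, inner_smul_right]
      rw [e2, e3] at e1
      refine e1.trans ((add_le_add (ih _) (ih _)).trans ?_)
      rw [← mul_add, mul_left_comm]
      refine mul_le_mul_of_nonneg_left ?_ hR0
      refine (add_le_add (amgm _ (by positivity)) (amgm _ (by positivity))).trans_eq ?_
      -- The cross terms of `‖z ± 2 Ψ x‖ ^ 2` cancel, so an example adds only `4 ‖Ψ x‖ ^ 2` on
      -- average over the signs.
      have par := parallelogram_law_with_norm ℝ z ((2 : ℝ) • Ψ x)
      rw [norm_smul, Real.norm_two] at par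
      rw [← add_div, mul_div_assoc']
      congr 1
      nlinarith [par]
    have hir : Integrable (fun x => R * ((‖z‖ ^ 2 + 4 * ‖Ψ x‖ ^ 2 + 4 * n * κ + c ^ 2) / (2 * c)))
        D :=
      (((((integrable_const _).add (hΨ.const_mul 4)).add (integrable_const _)).add
        (integrable_const _)).div_const _).const_mul _
    calc ∫ x, U (A + fun i => m i - ℓ x i) ∂D
        ≤ ∫ x, (1 / 2 * U (A + (2 : ℝ) • m) + 1 / 2 * U (A - (2 : ℝ) • ℓ x)) ∂D :=
          integral_mono hi0 ((integrable_const _).add (hi2.const_mul _)) split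
      _ = 1 / 2 * U (A + (2 : ℝ) • m) + 1 / 2 * ∫ x, U (A - (2 : ℝ) • ℓ x) ∂D := by
          rw [integral_add (integrable_const _) (hi2.const_mul _), integral_const_mul, integral_const_mul]
          simp
      _ ≤ 1 / 2 * (∫ x, U (A + (2 : ℝ) • ℓ x) ∂D) + 1 / 2 * ∫ x, U (A - (2 : ℝ) • ℓ x) ∂D := by
          gcongr
      _ = ∫ x, 1 / 2 * (U (A + (2 : ℝ) • ℓ x) + U (A - (2 : ℝ) • ℓ x)) ∂D := by
          rw [integral_const_mul, integral_add hi1 hi2]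
          ring
      _ ≤ ∫ x, R * ((‖z‖ ^ 2 + 4 * ‖Ψ x‖ ^ 2 + 4 * n * κ + c ^ 2) / (2 * c)) ∂D := by
          refine integral_mono ((hi1.add hi2).const_mul _) hir fun x => ?_
          have := point x
          simp only
          linarith
      _ = R * ((‖z‖ ^ 2 + 4 * (∫ x, ‖Ψ x‖ ^ 2 ∂D) + 4 * n * κ + c ^ 2) / (2 * c)) := by
          rw [integral_const_mul, integral_div, integral_add, integral_add, integral_add,
            integral_const_mul]
          · simp
          all_goals first
            | exact integrable_const _
            | exact hΨ.const_mul 4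
            | exact (integrable_const _).add (hΨ.const_mul 4)
            | exact ((integrable_const _).add (hΨ.const_mul 4)).add (integrable_const _)
      _ ≤ R * c := by
          refine mul_le_mul_of_nonneg_left ?_ hR0
          rw [div_le_iff₀ (by positivity)]
          nlinarith

variable {B : ℝ} {L : ℝ → ℝ → ℝ} {f : X → ℝ} {Ψ : X → H}

theorem IsLoss.measurable_comp (hL : IsLoss B L) (hf : Measurable f)
    (hΨ : ∀ θ, Measurable fun x => inner ℝ θ (Ψ x)) (θ : H) :
    Measurable fun x => L (f x) (inner ℝ θ (Ψ x)) :=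
  hL.measurable.comp (hf.prodMk (hΨ θ))

/-- A uniform deviation bound for finitely many linear predictors. -/
theorem measure_exists_deviation_le_of_finite {R κ t : ℝ} (hL : IsLoss B L) (hB0 : 0 < B)
    (hf : Measurable f) (hΨ : ∀ θ, Measurable fun x => inner ℝ θ (Ψ x))
    (hint : Integrable (fun x => ‖Ψ x‖ ^ 2) D) (hκ : ∫ x, ‖Ψ x‖ ^ 2 ∂D ≤ κ) (hκ0 : 0 < κ)
    (ht : 0 < t) (n : ℕ) (F : Finset H) (hR : ∀ θ ∈ F, ‖θ‖ ≤ R) :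
    (Measure.pi fun _ : Fin n => D) {x | ∃ θ ∈ F,
        (∑ j, L (f (x j)) (inner ℝ θ (Ψ (x j)))) + (2 * R * √(n * κ) + n * t)
          < n * ∫ y, L (f y) (inner ℝ θ (Ψ y)) ∂D}
      ≤ ENNReal.ofReal (Real.exp (-(2 * n * t ^ 2 / B ^ 2))) := by
  rcases F.eq_empty_or_nonempty with rfl | hF
  · simp
  have : Nonempty F := hF.to_subtype
  set ℓ : X → F → ℝ := fun x i => L (f x) (inner ℝ (i : H) (Ψ x)) with hℓdef
  have hℓ : ∀ i, Measurable fun x => ℓ x i := fun i => hL.measurable_comp hf hΨ _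
  have h0 : ∀ x i, 0 ≤ ℓ x i := fun x i => hL.nonneg _ _
  have hB : ∀ x i, ℓ x i ≤ B := fun x i => hL.le_bound _ _
  have hlip : ∀ x (i j : F), |ℓ x i - ℓ x j| ≤ |inner ℝ (i : H) (Ψ x) - inner ℝ (j : H) (Ψ x)| :=
    fun x i j => by
      have := (hL.lipschitz (f x)).dist_le_mul (inner ℝ (i : H) (Ψ x)) (inner ℝ (j : H) (Ψ x))
      simpa [Real.dist_eq] using this
  have hsup := expectedSup_inner_le (θ := fun i : F => (i : H)) (fun i => hR i i.2) hint hκ hκ0 hℓ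
    h0 hB hlip n 0
  -- This value minimizes the Chernoff exponent `n * (lam ^ 2 * B ^ 2 / 8) - lam * (n * t)`.
  set lam : ℝ := 4 * t / B ^ 2 with hlam
  have hlam0 : 0 < lam := by positivity
  have hexp := lintegral_exp_sup_le (D := D) hℓ h0 hB lam n 0
  set s : ℝ := 2 * R * √(n * κ) + n * t with hs
  set S : (Fin n → X) → ℝ := fun x => Finset.univ.sup' Finset.univ_nonempty
    ((0 : F → ℝ) + ∑ j, fun i => (∫ y, ℓ y i ∂D) - ℓ (x j) i) with hS
  have hSm : Measurable S := by
    refine IsSupLike.sup'.measurable_comp fun i => ?_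
    simp only [Pi.add_apply, Finset.sum_apply]
    exact (Finset.measurable_sum _ fun j _ => ((hℓ i).comp (measurable_pi_apply j)).const_sub
      _).const_add _
  have hsub : {x : Fin n → X | ∃ θ ∈ F,
        (∑ j, L (f (x j)) (inner ℝ θ (Ψ (x j)))) + s < n * ∫ y, L (f y) (inner ℝ θ (Ψ y)) ∂D}
      ⊆ {x | ENNReal.ofReal (Real.exp (lam * s)) ≤ ENNReal.ofReal (Real.exp (lam * S x))} := by
    rintro x ⟨θ, hθ, hx⟩
    refine ENNReal.ofReal_le_ofReal (Real.exp_le_exp.2 (mul_le_mul_of_nonneg_left ?_ hlam0.le))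
    have h1 := Finset.le_sup' ((0 : F → ℝ) + ∑ j, fun i => (∫ y, ℓ y i ∂D) - ℓ (x j) i)
      (Finset.mem_univ (⟨θ, hθ⟩ : F))
    refine le_trans ?_ h1
    simp only [Pi.add_apply, Finset.sum_apply, Pi.zero_apply, zero_add, Finset.sum_sub_distrib,
      Finset.sum_const, Finset.card_univ, Fintype.card_fin, nsmul_eq_mul, hℓdef]
    linarith
  refine (measure_mono hsub).trans ?_
  have hmarkov := meas_ge_le_lintegral_div (μ := Measure.pi fun _ : Fin n => D)
    (f := fun x => ENNReal.ofReal (Real.exp (lam * S x)))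
    (ENNReal.measurable_ofReal.comp (Real.measurable_exp.comp (hSm.const_mul lam))).aemeasurable
    (ε := ENNReal.ofReal (Real.exp (lam * s)))
    (by simpa using Real.exp_pos _) ENNReal.ofReal_ne_top
  refine hmarkov.trans ((ENNReal.div_le_div_right hexp _).trans ?_)
  rw [← ENNReal.ofReal_div_of_pos (Real.exp_pos _), ← Real.exp_sub]
  refine ENNReal.ofReal_le_ofReal (Real.exp_le_exp.2 ?_)
  have e0 : (fun i : F => inner ℝ (i : H) (0 : H)) = 0 := by
    ext i
    simp
  rw [e0] at hsup
  have e1 : √(‖(0 : H)‖ ^ 2 + 4 * n * κ) = 2 * √(n * κ) := by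
    rw [norm_zero, show (0 : ℝ) ^ 2 + 4 * n * κ = 2 ^ 2 * (n * κ) by ring,
      Real.sqrt_mul (by norm_num), Real.sqrt_sq (by norm_num)]
  rw [e1] at hsup
  have e2 := mul_le_mul_of_nonneg_left hsup hlam0.le
  have e3 : n * (lam ^ 2 * B ^ 2 / 8) - lam * (n * t) = -(2 * n * t ^ 2 / B ^ 2) := by
    rw [hlam]
    field_simp
    ring
  rw [← e3, hs]
  linarith

/-- A uniform deviation bound for countably many linear predictors of bounded norm. -/
theorem measure_exists_deviation_le {R κ t : ℝ} (hL : IsLoss B L) (hB0 : 0 < B)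
    (hf : Measurable f) (hΨ : ∀ θ, Measurable fun x => inner ℝ θ (Ψ x))
    (hint : Integrable (fun x => ‖Ψ x‖ ^ 2) D) (hκ : ∫ x, ‖Ψ x‖ ^ 2 ∂D ≤ κ) (hκ0 : 0 < κ)
    (ht : 0 < t) (n : ℕ) {c : Set H} (hc : c.Countable) (hR : ∀ θ ∈ c, ‖θ‖ ≤ R) :
    (Measure.pi fun _ : Fin n => D) {x | ∃ θ ∈ c,
        (∑ j, L (f (x j)) (inner ℝ θ (Ψ (x j)))) + (2 * R * √(n * κ) + n * t)
          < n * ∫ y, L (f y) (inner ℝ θ (Ψ y)) ∂D}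
      ≤ ENNReal.ofReal (Real.exp (-(2 * n * t ^ 2 / B ^ 2))) := by
  classical
  rcases c.eq_empty_or_nonempty with rfl | hne
  · simp
  obtain ⟨e, rfl⟩ := hc.exists_eq_range hne
  -- The bound for finite sets does not involve their cardinality, so it passes to an increasing
  -- union.
  have hun : {x : Fin n → X | ∃ θ ∈ Set.range e,
        (∑ j, L (f (x j)) (inner ℝ θ (Ψ (x j)))) + (2 * R * √(n * κ) + n * t)
          < n * ∫ y, L (f y) (inner ℝ θ (Ψ y)) ∂D} =
      ⋃ N : ℕ, {x | ∃ θ ∈ (Finset.range N).image e,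
        (∑ j, L (f (x j)) (inner ℝ θ (Ψ (x j)))) + (2 * R * √(n * κ) + n * t)
          < n * ∫ y, L (f y) (inner ℝ θ (Ψ y)) ∂D} := by
    ext x
    simp only [Set.mem_ofPred_eq, Set.mem_iUnion]
    constructor
    · rintro ⟨_, ⟨k, rfl⟩, hk⟩
      exact ⟨k + 1, e k, Finset.mem_image_of_mem _ (Finset.self_mem_range_succ k), hk⟩
    · rintro ⟨N, θ, hθ, h⟩
      obtain ⟨k, -, rfl⟩ := Finset.mem_image.1 hθ
      exact ⟨_, ⟨k, rfl⟩, h⟩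
  rw [hun, Monotone.measure_iUnion]
  · refine iSup_le fun N => measure_exists_deviation_le_of_finite hL hB0 hf hΨ hint hκ hκ0 ht n _ ?_
    intro θ hθ
    obtain ⟨k, -, rfl⟩ := Finset.mem_image.1 hθ
    exact hR _ ⟨k, rfl⟩
  · rintro N N' h x ⟨θ, hθ, hx⟩
    exact ⟨θ, Finset.image_subset_image (Finset.range_subset_range.2 h) hθ, hx⟩

/-- A deviation bound extends to the closure of a set of linear predictors. -/
theorem risk_le_of_mem_closure (hL : IsLoss B L) (hf : Measurable f)
    (hΨ : ∀ θ, Measurable fun x => inner ℝ θ (Ψ x)) {n : ℕ} {s : ℝ} (x : Fin n → X) {c : Set H}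
    (h : ∀ θ ∈ c, n * ∫ y, L (f y) (inner ℝ θ (Ψ y)) ∂D
      ≤ (∑ j, L (f (x j)) (inner ℝ θ (Ψ (x j)))) + s) {θ : H} (hθ : θ ∈ closure c) :
    n * ∫ y, L (f y) (inner ℝ θ (Ψ y)) ∂D ≤ (∑ j, L (f (x j)) (inner ℝ θ (Ψ (x j)))) + s := by
  have hcont : ∀ y, Continuous fun θ : H => L (f y) (inner ℝ θ (Ψ y)) := fun y =>
    (hL.lipschitz _).continuous.comp (continuous_id.inner continuous_const)
  refine closure_minimal (t := {θ : H | n * ∫ y, L (f y) (inner ℝ θ (Ψ y)) ∂D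
    ≤ (∑ j, L (f (x j)) (inner ℝ θ (Ψ (x j)))) + s}) h (isClosed_le ?_ ?_) hθ
  · refine continuous_const.mul (continuous_of_dominated (bound := fun _ => B)
      (fun θ => (hL.measurable_comp hf hΨ θ).aestronglyMeasurable) (fun θ => ?_)
      (integrable_const _) (Filter.Eventually.of_forall hcont))
    refine Filter.Eventually.of_forall fun y => ?_
    rw [Real.norm_eq_abs, abs_of_nonneg (hL.nonneg _ _)]
    exact hL.le_bound _ _
  · exact (continuous_finsetSum _ fun j _ => hcont _).add continuous_const

end UniformConvergence

/-! ### The feature space of a dot product kernel -/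

section Features

variable {d : ℕ}

/-- The pure tensor `β 0 ⊗ ⋯ ⊗ β (k - 1)` in coordinates. -/
noncomputable def pureTensor {k : ℕ} (β : Fin k → EuclideanSpace ℝ (Fin d)) :
    EuclideanSpace ℝ (Fin k → Fin d) :=
  WithLp.toLp 2 fun J => ∏ i, β i (J i)

/-- Multiplying out the product of the coordinate sums gives a sum over all multi-indices `J`. -/
theorem inner_pureTensor {k : ℕ} (β γ : Fin k → EuclideanSpace ℝ (Fin d)) :
    inner ℝ (pureTensor β) (pureTensor γ) = ∏ i, inner ℝ (β i) (γ i) := by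
  simp only [PiLp.inner_apply, pureTensor, Finset.prod_univ_sum, Fintype.piFinset_univ]
  refine Finset.sum_congr rfl fun J _ => ?_
  simp [Finset.prod_mul_distrib]

theorem norm_pureTensor {k : ℕ} (β : Fin k → EuclideanSpace ℝ (Fin d)) :
    ‖pureTensor β‖ = ∏ i, ‖β i‖ := by
  have h : ‖pureTensor β‖ ^ 2 = (∏ i, ‖β i‖) ^ 2 := by
    rw [← real_inner_self_eq_norm_sq, inner_pureTensor, ← Finset.prod_pow]
    simp
  exact (sq_eq_sq₀ (norm_nonneg _) (by positivity)).1 h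

theorem SlowlyDecaying.pos {b : ℕ → ℝ} (hb : SlowlyDecaying b) (k : ℕ) : 0 < b k := by
  rcases Nat.eq_zero_or_pos k with rfl | hk
  · exact hb.zero_pos
  · obtain ⟨c, hc, h⟩ := hb.lower
    exact lt_of_lt_of_le (by positivity) (h k hk)

theorem SlowlyDecaying.tsum_pos {b : ℕ → ℝ} (hb : SlowlyDecaying b) : 0 < ∑' k, b k :=
  hb.summable.tsum_pos (fun k => (hb.pos k).le) 0 (hb.pos 0)

/-- The indicator of `k = 0` treats the constant term together with the others; it is the source of
the summand `g̃(0) h̃(0)` in `√M`. -/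
theorem SlowlyDecaying.exists_inv_sqrt_le {b : ℕ → ℝ} (hb : SlowlyDecaying b) :
    ∃ c : ℝ, ∀ k : ℕ, (√(b k))⁻¹ ≤ c * (k + if k = 0 then 1 else 0) := by
  obtain ⟨c, hc, h⟩ := hb.lower
  have h0 : 0 < √(b 0) := Real.sqrt_pos.2 hb.zero_pos
  have hc' : 0 < √c := Real.sqrt_pos.2 hc
  refine ⟨(√(b 0))⁻¹ + (√c)⁻¹, fun k => ?_⟩
  rcases Nat.eq_zero_or_pos k with rfl | hk
  · simp [hc'.le]
  · have hk' : (0 : ℝ) < k := by exact_mod_cast hk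
    have h1 : √c / k ≤ √(b k) := by
      have := Real.sqrt_le_sqrt (h k hk)
      rwa [Real.sqrt_div hc.le, Real.sqrt_sq hk'.le] at this
    rw [if_neg hk.ne', add_zero]
    calc (√(b k))⁻¹ ≤ (√c / k)⁻¹ := inv_anti₀ (by positivity) h1
      _ = (√c)⁻¹ * k := by rw [inv_div, div_eq_inv_mul]
      _ ≤ _ := by
        gcongr
        linarith [inv_pos.2 h0]

theorem abs_inner_sphere_le (x x' : UnitSphere d) :
    |inner ℝ (x : EuclideanSpace ℝ (Fin d)) (x' : EuclideanSpace ℝ (Fin d))| ≤ 1 := by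
  have := abs_real_inner_le_norm (x : EuclideanSpace ℝ (Fin d)) (x' : EuclideanSpace ℝ (Fin d))
  simpa using this

theorem dotKernel_self (b : ℕ → ℝ) (x : UnitSphere d) : dotKernel b x x = ∑' k, b k := by
  simp [dotKernel]

theorem continuous_dotKernel {b : ℕ → ℝ} (hb : SlowlyDecaying b) :
    Continuous fun p : UnitSphere d × UnitSphere d => dotKernel b p.1 p.2 := by
  refine continuous_tsum (u := b) (fun k => by fun_prop) hb.summable fun k p => ?_
  rw [norm_mul, norm_pow, Real.norm_eq_abs, Real.norm_eq_abs, abs_of_pos (hb.pos k)]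
  exact mul_le_of_le_one_right (hb.pos k).le
    (pow_le_one₀ (abs_nonneg _) (abs_inner_sphere_le p.1 p.2))

/-- The Hilbert sum of the tensor powers of `ℝ^d`. -/
abbrev TensorSpace (d : ℕ) : Type := lp (fun k : ℕ => EuclideanSpace ℝ (Fin k → Fin d)) 2

/-- The feature map of the kernel `dotKernel b`. -/
noncomputable def dotFeature {b : ℕ → ℝ} (hb : SlowlyDecaying b) (x : UnitSphere d) :
    TensorSpace d :=
  ⟨fun k => √(b k) • pureTensor fun _ : Fin k => (x : EuclideanSpace ℝ (Fin d)), by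
    refine memℓp_gen ?_
    refine hb.summable.congr fun k => ?_
    rw [norm_smul, norm_pureTensor]
    simp [Real.sq_sqrt (hb.pos k).le]⟩

/-- The vector that represents `x ↦ ∏ i, ⟪β i, x⟫`. -/
noncomputable def monomialVector (b : ℕ → ℝ) {k : ℕ} (β : Fin k → EuclideanSpace ℝ (Fin d)) :
    TensorSpace d :=
  lp.single 2 k ((√(b k))⁻¹ • pureTensor β)

variable {b : ℕ → ℝ} (hb : SlowlyDecaying b)

theorem inner_dotFeature (x x' : UnitSphere d) :
    inner ℝ (dotFeature hb x) (dotFeature hb x') = dotKernel b x x' := by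
  rw [lp.inner_eq_tsum, dotKernel]
  refine tsum_congr fun k => ?_
  simp only [dotFeature]
  rw [inner_smul_left, inner_smul_right, inner_pureTensor]
  simp [← mul_assoc, Real.mul_self_sqrt (hb.pos k).le]

theorem norm_dotFeature_sq (x : UnitSphere d) : ‖dotFeature hb x‖ ^ 2 = ∑' k, b k := by
  rw [← real_inner_self_eq_norm_sq, inner_dotFeature, dotKernel_self]

/-- The squared distance of two features is `2 ∑ b k - 2 K(y, x)`, so continuity of the kernel
suffices. -/
theorem continuous_dotFeature : Continuous (dotFeature (d := d) hb) := by
  rw [continuous_iff_continuousAt]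
  intro x
  rw [ContinuousAt, tendsto_iff_norm_sub_tendsto_zero]
  have h : ∀ y, ‖dotFeature hb y - dotFeature hb x‖ =
      √(2 * (∑' k, b k) - 2 * dotKernel b y x) := fun y => by
    rw [← Real.sqrt_sq (norm_nonneg _), norm_sub_sq_real, norm_dotFeature_sq, norm_dotFeature_sq,
      inner_dotFeature]
    ring_nf
  simp_rw [h]
  have hc : Continuous fun y : UnitSphere d => √(2 * (∑' k, b k) - 2 * dotKernel b y x) :=
    Real.continuous_sqrt.comp (continuous_const.sub (continuous_const.mul
      ((continuous_dotKernel hb).comp (Continuous.prodMk_left x))))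
  have := hc.tendsto x
  rwa [dotKernel_self, sub_self, Real.sqrt_zero] at this

theorem inner_monomialVector {k : ℕ} (β : Fin k → EuclideanSpace ℝ (Fin d)) (x : UnitSphere d) :
    inner ℝ (monomialVector b β) (dotFeature hb x) =
      ∏ i, inner ℝ (β i) (x : EuclideanSpace ℝ (Fin d)) := by
  have hs : √(b k) ≠ 0 := (Real.sqrt_pos.2 (hb.pos k)).ne'
  rw [monomialVector, lp.inner_single_left]
  simp only [dotFeature]
  rw [inner_smul_left, inner_smul_right, inner_pureTensor, ← mul_assoc]
  simp [hs]

theorem norm_monomialVector {k : ℕ} (β : Fin k → EuclideanSpace ℝ (Fin d)) :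
    ‖monomialVector b β‖ = (√(b k))⁻¹ * ∏ i, ‖β i‖ := by
  rw [monomialVector, lp.norm_single (by norm_num), norm_smul, norm_pureTensor]
  simp

/-- The features of distinct points are linearly independent. -/
theorem linearIndependent_dotFeature : LinearIndependent ℝ (dotFeature (d := d) hb) := by
  classical
  rw [linearIndependent_iff']
  intro s α h z hz
  -- Pairing with the `k`-th tensor power of `z` isolates degree `k`, which is possible because
  -- every `b k` is positive.
  have hpow : ∀ k : ℕ, ∑ x ∈ s, α x *
      (inner ℝ (z : EuclideanSpace ℝ (Fin d)) (x : EuclideanSpace ℝ (Fin d))) ^ k = 0 :=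
    fun k => by
      have := congrArg (inner ℝ (monomialVector b fun _ : Fin k => (z : EuclideanSpace ℝ (Fin d)))) h
      rw [inner_sum, inner_zero_right] at this
      rw [← this]
      refine Finset.sum_congr rfl fun x _ => ?_
      rw [inner_smul_right, inner_monomialVector]
      simp
  have hpoly : ∀ p : Polynomial ℝ, ∑ x ∈ s, α x *
      p.eval (inner ℝ (z : EuclideanSpace ℝ (Fin d)) (x : EuclideanSpace ℝ (Fin d))) = 0 :=
    fun p => by
      simp_rw [Polynomial.eval_eq_sum_range, Finset.mul_sum]
      rw [Finset.sum_comm]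
      refine Finset.sum_eq_zero fun k _ => ?_
      rw [← mul_zero (p.coeff k), ← hpow k, Finset.mul_sum]
      exact Finset.sum_congr rfl fun x _ => by ring
  -- This polynomial vanishes at `⟪z, x⟫` for all `x ≠ z` in `s`, but not at `⟪z, z⟫ = 1`: distinct
  -- unit vectors have inner product different from `1`.
  have key := hpoly (∏ x ∈ s.erase z, (Polynomial.X - Polynomial.C
    (inner ℝ (z : EuclideanSpace ℝ (Fin d)) (x : EuclideanSpace ℝ (Fin d)))))
  rw [Finset.sum_eq_single_of_mem z hz] at key
  · refine (mul_eq_zero.1 key).resolve_right ?_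
    rw [Polynomial.eval_prod]
    refine Finset.prod_ne_zero_iff.2 ?_
    intro x hx
    have hzx : (z : EuclideanSpace ℝ (Fin d)) ≠ x := fun e =>
      (Finset.mem_erase.1 hx).1 (Subtype.ext e).symm
    have h1 : inner ℝ (z : EuclideanSpace ℝ (Fin d)) (x : EuclideanSpace ℝ (Fin d)) ≠ 1 := fun e =>
      hzx ((inner_eq_one_iff_of_norm_eq_one (by simp) (by simp)).1 e)
    simp only [Polynomial.eval_sub, Polynomial.eval_X, Polynomial.eval_C]
    rw [real_inner_self_eq_norm_sq, norm_eq_of_mem_sphere, one_pow, sub_ne_zero]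
    exact h1.symm
  · intro x hx hxz
    rw [Polynomial.eval_prod, Finset.prod_eq_zero (Finset.mem_erase.2 ⟨hxz, hx⟩), mul_zero]
    simp

end Features

/-! ### Products of power series in the feature space -/

namespace MultiPowerSeries

variable {d : ℕ} {P : MultiPowerSeries.{u} d} {g : UnitSphere d → ℝ}

/-- The absolute value of a term, with `‖β v i‖` in place of `⟪β v i, x⟫`. -/
noncomputable def termNorm (P : MultiPowerSeries.{u} d) (p : Σ k, P.V k) : ℝ :=
  |P.a p.1 p.2| * ∏ i, ‖P.β p.1 p.2 i‖

theorem termNorm_nonneg (p : Σ k, P.V k) : 0 ≤ P.termNorm p :=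
  mul_nonneg (abs_nonneg _) (Finset.prod_nonneg fun _ _ => norm_nonneg _)

/-- Tonelli for nonnegative series. The weights `1`, `k` and the indicator of `k = 0` yield `g̃(1)`,
`g̃'(1)` and `g̃(0)`. -/
theorem Represents.hasSum_weighted (hP : P.Represents g) {c : ℕ → ℝ} (hc : ∀ k, 0 ≤ c k)
    (hs : Summable fun k => c k * P.tildeCoeff k) :
    HasSum (fun p : Σ k, P.V k => c p.1 * P.termNorm p) (∑' k, c k * P.tildeCoeff k) := by
  have h1 : ∀ k, ∑' v : P.V k, c k * P.termNorm ⟨k, v⟩ = c k * P.tildeCoeff k := fun k =>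
    tsum_mul_left
  have hsum : Summable fun p : Σ k, P.V k => c p.1 * P.termNorm p := by
    refine (summable_sigma_of_nonneg fun p => mul_nonneg (hc _) (termNorm_nonneg p)).2
      ⟨fun k => (hP.summable_terms k).mul_left (c k), ?_⟩
    simpa only [h1] using hs
  rw [show ∑' k, c k * P.tildeCoeff k = ∑' k, ∑' v : P.V k, c k * P.termNorm ⟨k, v⟩ from
    tsum_congr fun k => (h1 k).symm]
  rw [← hsum.tsum_sigma]
  exact hsum.hasSum

theorem Represents.hasSum_termNorm (hP : P.Represents g) : HasSum P.termNorm (P.tilde 1) := by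
  have h := hP.hasSum_weighted (c := fun _ => 1) (fun _ => zero_le_one)
    (by simpa using hP.summable_tilde)
  simpa [tilde] using h

theorem Represents.hasSum_order_mul_termNorm (hP : P.Represents g) :
    HasSum (fun p : Σ k, P.V k => (p.1 : ℝ) * P.termNorm p) (P.tildeDeriv 1) := by
  have h := hP.hasSum_weighted (c := fun k => (k : ℝ)) (fun _ => Nat.cast_nonneg _)
    (by simpa using hP.summable_tildeDeriv)
  simpa [tildeDeriv] using h

theorem Represents.hasSum_termNorm_zero (hP : P.Represents g) :
    HasSum (fun p : Σ k, P.V k => (if p.1 = 0 then 1 else 0) * P.termNorm p) (P.tilde 0) := by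
  have hs : ∀ k ∉ ({0} : Finset ℕ), (if k = 0 then (1 : ℝ) else 0) * P.tildeCoeff k = 0 :=
    fun k hk => by simp_all
  have h := hP.hasSum_weighted (c := fun k => if k = 0 then 1 else 0)
    (fun k => by split_ifs <;> norm_num) (summable_of_ne_finset_zero hs)
  convert h using 1
  refine tsum_congr fun k => ?_
  rcases Nat.eq_zero_or_pos k with rfl | hk
  · simp
  · simp [hk.ne', zero_pow hk.ne']

theorem abs_term_le (p : Σ k, P.V k) (x : UnitSphere d) :
    |P.a p.1 p.2 * ∏ i, inner ℝ (P.β p.1 p.2 i) (x : EuclideanSpace ℝ (Fin d))|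
      ≤ P.termNorm p := by
  rw [abs_mul, Finset.abs_prod, termNorm]
  gcongr with i
  simpa using abs_real_inner_le_norm (P.β p.1 p.2 i) (x : EuclideanSpace ℝ (Fin d))

/-- Absolute convergence turns the iterated sum into an unconditional one, as multiplying two series
requires. -/
theorem Represents.hasSum (hP : P.Represents g) (x : UnitSphere d) :
    HasSum (fun p : Σ k, P.V k => P.a p.1 p.2 *
      ∏ i, inner ℝ (P.β p.1 p.2 i) (x : EuclideanSpace ℝ (Fin d))) (g x) := by
  have hs : Summable fun p : Σ k, P.V k => P.a p.1 p.2 *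
      ∏ i, inner ℝ (P.β p.1 p.2 i) (x : EuclideanSpace ℝ (Fin d)) :=
    Summable.of_norm_bounded hP.hasSum_termNorm.summable fun p => abs_term_le p x
  rw [hP.eq_sum, MultiPowerSeries.sum, ← hs.tsum_sigma]
  exact hs.hasSum

/-- The product of two power series is represented by a vector of the feature space whose norm is
controlled by the auxiliary functions. -/
theorem Represents.exists_vector_mul {Q : MultiPowerSeries.{v} d} {h : UnitSphere d → ℝ}
    (hP : P.Represents g) (hQ : Q.Represents h) {b : ℕ → ℝ} (hb : SlowlyDecaying b) {c : ℝ}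
    (hc : ∀ k : ℕ, (√(b k))⁻¹ ≤ c * (k + if k = 0 then 1 else 0)) :
    ∃ θ : TensorSpace d, (∀ x, inner ℝ θ (dotFeature hb x) = g x * h x) ∧
      ‖θ‖ ≤ c * (P.tildeDeriv 1 * Q.tilde 1 + P.tilde 1 * Q.tildeDeriv 1
        + P.tilde 0 * Q.tilde 0) := by
  have mulSum : ∀ {F : (Σ k, P.V k) → ℝ} {G : (Σ k, Q.V k) → ℝ} {s t : ℝ}, HasSum F s →
      HasSum G t → (∀ p, 0 ≤ F p) → (∀ q, 0 ≤ G q) →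
      HasSum (fun z : (Σ k, P.V k) × (Σ k, Q.V k) => F z.1 * G z.2) (s * t) :=
    fun hs ht hF hG => hs.mul ht (hs.summable.mul_of_nonneg ht.summable hF hG)
  have hz : ∀ k : ℕ, (0 : ℝ) ≤ if k = 0 then 1 else 0 := fun k => by split_ifs <;> norm_num
  have b1 := mulSum hP.hasSum_order_mul_termNorm hQ.hasSum_termNorm
    (fun p => mul_nonneg (Nat.cast_nonneg _) (termNorm_nonneg p)) termNorm_nonneg
  have b2 := mulSum hP.hasSum_termNorm hQ.hasSum_order_mul_termNorm termNorm_nonneg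
    (fun p => mul_nonneg (Nat.cast_nonneg _) (termNorm_nonneg p))
  have b3 := mulSum hP.hasSum_termNorm_zero hQ.hasSum_termNorm_zero
    (fun p => mul_nonneg (hz _) (termNorm_nonneg p))
    (fun p => mul_nonneg (hz _) (termNorm_nonneg p))
  have hbound := ((b1.add b2).add b3).mul_left c
  -- A product of two monomials is the monomial of the concatenated list of directions.
  set vec : (Σ k, P.V k) × (Σ k, Q.V k) → TensorSpace d := fun z =>
    (P.a z.1.1 z.1.2 * Q.a z.2.1 z.2.2) •
      monomialVector b (Fin.append (P.β z.1.1 z.1.2) (Q.β z.2.1 z.2.2)) with hvec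
  -- With `k` and `l` the two degrees, the weight `k + l` plus the indicator of `k + l = 0` equals
  -- `k + l` plus the product of the indicators of `k = 0` and `l = 0`. These three parts sum to the
  -- three summands of `√M`.
  have hnorm : ∀ z, ‖vec z‖ ≤ c * ((z.1.1 : ℝ) * P.termNorm z.1 * Q.termNorm z.2
      + P.termNorm z.1 * ((z.2.1 : ℝ) * Q.termNorm z.2)
      + (if z.1.1 = 0 then 1 else 0) * P.termNorm z.1 *
        ((if z.2.1 = 0 then 1 else 0) * Q.termNorm z.2)) := fun z => by
    have hnn : 0 ≤ P.termNorm z.1 * Q.termNorm z.2 :=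
      mul_nonneg (termNorm_nonneg _) (termNorm_nonneg _)
    have e1 : ‖vec z‖ = (√(b (z.1.1 + z.2.1)))⁻¹ * (P.termNorm z.1 * Q.termNorm z.2) := by
      rw [hvec]
      simp only [norm_smul, norm_monomialVector, Fin.prod_univ_add, Fin.append_left,
        Fin.append_right, termNorm, Real.norm_eq_abs, abs_mul]
      ring
    have e2 : (if z.1.1 + z.2.1 = 0 then (1 : ℝ) else 0) =
        (if z.1.1 = 0 then 1 else 0) * (if z.2.1 = 0 then 1 else 0) := by
      by_cases h1 : z.1.1 = 0 <;> by_cases h2 : z.2.1 = 0 <;> simp [h1, h2]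
    have e3 := mul_le_mul_of_nonneg_right (hc (z.1.1 + z.2.1)) hnn
    rw [e2, ← e1] at e3
    push_cast at e3
    linarith
  obtain ⟨θ, hθ⟩ : Summable vec := Summable.of_norm_bounded hbound.summable hnorm
  refine ⟨θ, fun x => ?_, hθ.norm_le_of_bounded hbound hnorm⟩
  have h1 := (innerSL ℝ (dotFeature hb x)).hasSum hθ
  rw [real_inner_comm]
  have hinner : ∀ z, innerSL ℝ (dotFeature hb x) (vec z) =
      (P.a z.1.1 z.1.2 * ∏ i, inner ℝ (P.β z.1.1 z.1.2 i) (x : EuclideanSpace ℝ (Fin d))) *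
      (Q.a z.2.1 z.2.2 * ∏ i, inner ℝ (Q.β z.2.1 z.2.2 i) (x : EuclideanSpace ℝ (Fin d))) :=
    fun z => by
      rw [innerSL_apply_apply, hvec]
      simp only [inner_smul_right]
      rw [real_inner_comm, inner_monomialVector, Fin.prod_univ_add]
      simp only [Fin.append_left, Fin.append_right]
      ring
  have habs := summable_mul_of_summable_norm (hP.hasSum x).summable.norm
    (hQ.hasSum x).summable.norm
  have h2 := (hP.hasSum x).mul (hQ.hasSum x) habs
  simp_rw [hinner] at h1
  exact h1.unique h2

end MultiPowerSeries

/-! ### Sample bounds -/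

section SampleBounds

variable {X : Type u} [MeasurableSpace X]

theorem IsLoss.mono {B B' : ℝ} {L : ℝ → ℝ → ℝ} (hL : IsLoss B L) (h : B ≤ B') : IsLoss B' L :=
  ⟨hL.measurable, hL.nonneg, fun y z => (hL.le_bound y z).trans h, hL.self_eq_zero, hL.lipschitz⟩

theorem IsLoss.le_abs_sub {B : ℝ} {L : ℝ → ℝ → ℝ} (hL : IsLoss B L) (y z : ℝ) :
    L y z ≤ |z - y| := by
  have := (hL.lipschitz y).dist_le_mul z y
  rw [hL.self_eq_zero, Real.dist_eq, Real.dist_eq, sub_zero, abs_of_nonneg (hL.nonneg _ _)] at this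
  simpa using this

variable {D : Measure X} [IsProbabilityMeasure D] {B ε δ : ℝ} {L : ℝ → ℝ → ℝ} {f : X → ℝ}

theorem generalizationError_lt (hL : IsLoss B L) (hf : Measurable f) {fhat : X → ℝ}
    (hfhat : Measurable fhat) (hε : 0 < ε) (h : ∫ x, L (f x) (fhat x) ∂D < ε) :
    generalizationError L D f fhat < ENNReal.ofReal ε := by
  have hm : Measurable fun x => L (f x) (fhat x) := hL.measurable.comp (hf.prodMk hfhat)
  rw [generalizationError, ← ofReal_integral_eq_lintegral_ofReal
    (Integrable.of_mem_Icc 0 B hm.aemeasurable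
      (Filter.Eventually.of_forall fun x => ⟨hL.nonneg _ _, hL.le_bound _ _⟩))
    (Filter.Eventually.of_forall fun x => hL.nonneg _ _)]
  exact (ENNReal.ofReal_lt_ofReal_iff hε).2 h

theorem generalizationError_zero_lt (hL : IsLoss B L) {r : ℝ} (hf : ∀ x, |f x| ≤ r) (hr : r < ε)
    (hε : 0 < ε) : generalizationError L D f (fun _ => 0) < ENNReal.ofReal ε := by
  calc generalizationError L D f (fun _ => 0) ≤ ∫⁻ _, ENNReal.ofReal r ∂D :=
        lintegral_mono fun x => ENNReal.ofReal_le_ofReal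
          ((hL.le_abs_sub _ _).trans (by simpa using hf x))
    _ = ENNReal.ofReal r := by simp
    _ < _ := (ENNReal.ofReal_lt_ofReal_iff hε).2 hr

theorem sampleBound_of_failureProb_lt {A : Learner.{u, v} X} {C M : ℝ} {n : ℕ}
    (hn : n ≤ C * (M + Real.log δ⁻¹) / ε ^ 2)
    (h : failureProb A L f D ε n < ENNReal.ofReal δ) : SampleBound A L C M f D ε δ := by
  have h1 : sampleComplexity A L f D ε δ ≤ n := iInf₂_le n h
  have h2 : (sampleComplexity A L f D ε δ : ℝ≥0∞) ≤ ((n : ℕ∞) : ℝ≥0∞) := by exact_mod_cast h1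
  refine h2.trans ?_
  rw [ENat.toENNReal_coe, ← ENNReal.ofReal_natCast]
  exact ENNReal.ofReal_le_ofReal hn

/-- If the sample bound is less than one, then predicting zero without any examples suffices. -/
theorem sampleBound_of_lt_one {A : Learner.{u, v} X} {C M r : ℝ} (hL : IsLoss B L) (hε : 0 < ε)
    (hδ : 0 < δ) (hC : 0 ≤ C * (M + Real.log δ⁻¹) / ε ^ 2) (hf : ∀ x, |f x| ≤ r) (hr : r < ε)
    (hA : ∀ data s, A.train 0 data s = fun _ => 0) : SampleBound A L C M f D ε δ := by
  refine sampleBound_of_failureProb_lt (n := 0) (by simpa using hC) ?_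
  have : failureProb A L f D ε 0 = 0 := by
    rw [failureProb]
    refine measure_mono_null (t := ∅) (fun p hp => hp ?_) measure_empty
    rw [hA]
    exact generalizationError_zero_lt hL hf hr hε
  rw [this]
  exact ENNReal.ofReal_pos.2 hδ

end SampleBounds

/-- The constant in the sample bound, for a kernel with `∑ b k = κ`, `(b 0)^(-1/2) ≤ c` and
`(b k)^(-1/2) ≤ c k` for `k ≥ 1`. -/
noncomputable def sampleConst (B κ c : ℝ) : ℝ := 1024 * κ * (c ^ 2 + 1) + 32 * (|B| + 1) ^ 2

/-! ### Arithmetic of the constants. -/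

section Constants

variable {B κ c ε M Λ : ℝ}

theorem sampleConst_pos (hκ : 0 < κ) : 0 < sampleConst B κ c := by
  unfold sampleConst
  positivity

theorem half_le_floor {y : ℝ} (hy : 1 ≤ y) : y / 2 ≤ (⌊y⌋₊ : ℝ) := by
  have h1 := Nat.lt_floor_add_one y
  have h2 : (1 : ℝ) ≤ (⌊y⌋₊ : ℝ) := by exact_mod_cast Nat.one_le_floor_iff _ |>.2 hy
  linarith

theorem sampleConst_mul_le (hε : 0 < ε) (h1 : 1 ≤ sampleConst B κ c * (M + Λ) / ε ^ 2) :
    sampleConst B κ c * (M + Λ) / 2 ≤ ⌊sampleConst B κ c * (M + Λ) / ε ^ 2⌋₊ * ε ^ 2 := by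
  have := mul_le_mul_of_nonneg_right (half_le_floor h1) (sq_nonneg ε)
  refine le_trans (le_of_eq ?_) this
  field_simp

/-- The radius `2 √(c ^ 2 * M + Λ)` has room for the weights of gradient descent, and `2 * κ` bounds
the mean squared norm of random features. The constant `512 = 32 * 16` comes from squaring the first
term and comparing it with `n * (ε / 4)`. -/
theorem deviation_le (hκ : 0 < κ) (hε : 0 < ε) (hM : 0 ≤ M) (hΛ : 0 < Λ)
    (h1 : 1 ≤ sampleConst B κ c * (M + Λ) / ε ^ 2) {n : ℕ}
    (hn : n = ⌊sampleConst B κ c * (M + Λ) / ε ^ 2⌋₊) :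
    2 * (2 * √(c ^ 2 * M + Λ)) * √(n * (2 * κ)) + n * (ε / 4) ≤ n * (ε / 2) := by
  have h2 := sampleConst_mul_le hε h1
  rw [← hn] at h2
  have h3 : 512 * κ * (c ^ 2 * M + Λ) ≤ n * ε ^ 2 := by
    refine le_trans ?_ h2
    unfold sampleConst
    have : 0 ≤ κ * (M + c ^ 2 * Λ) := by positivity
    have : 0 ≤ (|B| + 1) ^ 2 * (M + Λ) := by positivity
    nlinarith
  have h4 : 2 * (2 * √(c ^ 2 * M + Λ)) * √(n * (2 * κ)) ≤ n * (ε / 4) := by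
    refine le_of_sq_le_sq ?_ (by positivity)
    rw [mul_pow, mul_pow, mul_pow, Real.sq_sqrt (by positivity), Real.sq_sqrt (by positivity)]
    have := mul_le_mul_of_nonneg_left h3 (Nat.cast_nonneg (α := ℝ) n)
    nlinarith
  linarith

/-- The constant leaves a factor two to spare in the exponent, which makes the inequality strict.
The network argument spends the remaining probability on its two limits. -/
theorem exp_neg_lt {δ : ℝ} (hκ : 0 < κ) (hε : 0 < ε) (hM : 0 ≤ M) (hδ : 0 < δ) (hδ1 : δ < 1)
    (h1 : 1 ≤ sampleConst B κ c * (M + Real.log δ⁻¹) / ε ^ 2) {n : ℕ}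
    (hn : n = ⌊sampleConst B κ c * (M + Real.log δ⁻¹) / ε ^ 2⌋₊) :
    Real.exp (-(2 * n * (ε / 4) ^ 2 / (|B| + 1) ^ 2)) < δ := by
  have hΛ : 0 < Real.log δ⁻¹ := Real.log_pos ((one_lt_inv₀ hδ).2 hδ1)
  have h2 := sampleConst_mul_le hε h1
  rw [← hn] at h2
  rw [← Real.lt_log_iff_exp_lt hδ, neg_lt, ← Real.log_inv]
  rw [lt_div_iff₀ (by positivity)]
  have h3 : 16 * (|B| + 1) ^ 2 * Real.log δ⁻¹ ≤ n * ε ^ 2 := by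
    refine le_trans ?_ h2
    unfold sampleConst
    have : 0 ≤ κ * (c ^ 2 + 1) * (M + Real.log δ⁻¹) := by positivity
    have : 0 ≤ (|B| + 1) ^ 2 * M := by positivity
    nlinarith
  have : 0 < (|B| + 1) ^ 2 * Real.log δ⁻¹ := by positivity
  nlinarith

/-- For the regime where the sample bound is below one: the target function is then smaller than
`ε`, and zero examples must suffice. -/
theorem mul_sqrt_lt (hκ : 0 < κ) (hε : 0 < ε) (hM : 0 ≤ M) (hΛ : 0 < Λ)
    (h1 : sampleConst B κ c * (M + Λ) / ε ^ 2 < 1) : √(c ^ 2 * M * κ) < ε := by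
  rw [div_lt_one (by positivity)] at h1
  rw [Real.sqrt_lt' hε]
  refine lt_of_le_of_lt ?_ h1
  unfold sampleConst
  have e1 : 0 ≤ κ * c ^ 2 * M := by positivity
  have e2 : 0 ≤ κ * M := by positivity
  have e3 : 0 ≤ κ * (c ^ 2 + 1) * Λ := by positivity
  have e4 : 0 ≤ (|B| + 1) ^ 2 * (M + Λ) := by positivity
  nlinarith

end Constants

/-! ### Kernel regression -/

section Kernel

variable {X : Type u} {H : Type*} [NormedAddCommGroup H] [InnerProductSpace ℝ H] {K : X → X → ℝ}
  {Φ : X → H}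

/-- If the labels come from `⟪θ, Φ x⟫`, then kernel regression returns an interpolant in the span of
the features, of norm at most `‖θ‖`. -/
theorem exists_kernelInterpolant_eq (hΦ : ∀ x x', inner ℝ (Φ x) (Φ x') = K x x') (θ : H) {n : ℕ}
    (x : Fin n → X) :
    ∃ α : Fin n → ℝ, ‖∑ i, α i • Φ (x i)‖ ≤ ‖θ‖ ∧
      (∀ j, inner ℝ (∑ i, α i • Φ (x i)) (Φ (x j)) = inner ℝ θ (Φ (x j))) ∧
      kernelInterpolant K (fun i => (x i, inner ℝ θ (Φ (x i)))) =
        fun z => inner ℝ (∑ i, α i • Φ (x i)) (Φ z) := by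
  have hsum : ∀ (α : Fin n → ℝ) (z : X), inner ℝ (∑ i, α i • Φ (x i)) (Φ z) =
      ∑ i, α i * K (x i) z := fun α z => by
    simp [sum_inner, inner_smul_left, hΦ]
  have hex : ∃ α : Fin n → ℝ, ∀ j, ∑ i, K (x j) (x i) * α i = inner ℝ θ (Φ (x j)) := by
    -- The coefficients of the orthogonal projection of `θ` solve the interpolation system, even if
    -- examples repeat and the Gram matrix is singular.
    set V := Submodule.span ℝ (Set.range fun i => Φ (x i)) with hV
    have : FiniteDimensional ℝ V := FiniteDimensional.span_of_finite ℝ (Set.finite_range _)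
    obtain ⟨α, hα⟩ := (Submodule.mem_span_range_iff_exists_fun ℝ).1
      (V.starProjection_apply_mem θ)
    refine ⟨α, fun j => ?_⟩
    have h1 := V.starProjection_inner_eq_zero θ (Φ (x j)) (Submodule.subset_span ⟨j, rfl⟩)
    rw [inner_sub_left, sub_eq_zero, ← hα, hsum] at h1
    rw [h1]
    refine Finset.sum_congr rfl fun i _ => ?_
    rw [mul_comm, ← hΦ, ← hΦ, real_inner_comm]
  refine ⟨hex.choose, ?_, ?_, ?_⟩
  case refine_3 =>
    rw [kernelInterpolant, dif_pos hex]
    ext z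
    exact (hsum _ z).symm
  all_goals
    have hint : ∀ j, inner ℝ (∑ i, hex.choose i • Φ (x i)) (Φ (x j)) = inner ℝ θ (Φ (x j)) :=
      fun j => by
        rw [hsum, ← hex.choose_spec j]
        refine Finset.sum_congr rfl fun i _ => ?_
        rw [mul_comm, ← hΦ, ← hΦ, real_inner_comm]
  · set η := ∑ i, hex.choose i • Φ (x i) with hη
    -- `η` lies in the span of the features and pairs with them as `θ` does, whichever solution was
    -- chosen. Cauchy–Schwarz then gives `‖η‖ ≤ ‖θ‖`.
    have h2 : ‖η‖ ^ 2 = inner ℝ θ η := by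
      have h : ∀ w, (∀ j, inner ℝ w (Φ (x j)) = inner ℝ θ (Φ (x j))) →
          inner ℝ w η = inner ℝ θ η := fun w hw => by
        simp only [hη, inner_sum, inner_smul_right, hw]
      rw [← real_inner_self_eq_norm_sq, h η hint]
    have h3 := real_inner_le_norm θ η
    rw [← h2, sq] at h3
    rcases (norm_nonneg η).eq_or_lt with h0 | h0
    · rw [← h0]
      exact norm_nonneg θ
    · exact le_of_mul_le_mul_right h3 h0
  · exact hint

end Kernel

section KernelLearning

variable {d : ℕ} {b : ℕ → ℝ} (hb : SlowlyDecaying b) {B ε δ M c : ℝ} {L : ℝ → ℝ → ℝ}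
  {f : UnitSphere d → ℝ} {D : Measure (UnitSphere d)} [IsProbabilityMeasure D]

theorem abs_le_of_represented {θ : TensorSpace d} (hM : 0 ≤ M)
    (hθ : ∀ x, inner ℝ θ (dotFeature hb x) = f x) (hnorm : ‖θ‖ ≤ √(c ^ 2 * M))
    (x : UnitSphere d) : |f x| ≤ √(c ^ 2 * M * ∑' k, b k) := by
  rw [← hθ, Real.sqrt_mul (by positivity)]
  refine (abs_real_inner_le_norm _ _).trans (mul_le_mul hnorm ?_ (norm_nonneg _) (by positivity))
  rw [← norm_dotFeature_sq hb x, Real.sqrt_sq (norm_nonneg _)]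

theorem measurable_inner_dotFeature (θ : TensorSpace d) :
    Measurable fun x => inner ℝ θ (dotFeature hb x) :=
  (continuous_const.inner (continuous_dotFeature hb)).measurable

/-- The learned predictor has zero empirical loss and lies in a ball fixed before the examples are
drawn, so its risk is at most the uniform deviation. -/
theorem sampleBound_kernelLearner {θ : TensorSpace d} (hL : IsLoss B L) (hM : 0 ≤ M)
    (hθ : ∀ x, inner ℝ θ (dotFeature hb x) = f x) (hnorm : ‖θ‖ ≤ √(c ^ 2 * M))
    (hε : 0 < ε) (hδ : 0 < δ) (hδ1 : δ < 1) :
    SampleBound (kernelLearner (dotKernel b)) L (sampleConst B (∑' k, b k) c) M f D ε δ := by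
  have hκ := hb.tsum_pos
  set κ := ∑' k, b k with hκdef
  have hΛ : 0 < Real.log δ⁻¹ := Real.log_pos ((one_lt_inv₀ hδ).2 hδ1)
  have hC := sampleConst_pos (B := B) (c := c) hκ
  have hfm : Measurable f := by
    simpa only [hθ] using measurable_inner_dotFeature hb θ
  rcases lt_or_ge (sampleConst B κ c * (M + Real.log δ⁻¹) / ε ^ 2) 1 with h1 | h1
  · refine sampleBound_of_lt_one hL hε hδ (by positivity) (abs_le_of_represented hb hM hθ hnorm)
      (mul_sqrt_lt hκ hε hM hΛ h1) fun data s => ?_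
    change kernelInterpolant _ _ = _
    rw [kernelInterpolant]
    split_ifs
    · simp
    · rfl
  set n := ⌊sampleConst B κ c * (M + Real.log δ⁻¹) / ε ^ 2⌋₊ with hn
  have hn1 : 1 ≤ n := (Nat.one_le_floor_iff _).2 h1
  refine sampleBound_of_failureProb_lt (n := n) (Nat.floor_le (by positivity)) ?_
  -- Twice the radius needed here, so that the numerical estimate is shared with the network case.
  set R := 2 * √(c ^ 2 * M + Real.log δ⁻¹) with hR
  have hθR : ‖θ‖ ≤ R := by
    have : √(c ^ 2 * M) ≤ √(c ^ 2 * M + Real.log δ⁻¹) := Real.sqrt_le_sqrt (by linarith)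
    linarith [Real.sqrt_nonneg (c ^ 2 * M + Real.log δ⁻¹)]
  -- Interpolants lie in the span of the features, which is separable as the sphere is; a countable
  -- dense subset then suffices for the deviation bound.
  set S : Set (TensorSpace d) :=
    {η | η ∈ Submodule.span ℝ (Set.range (dotFeature (d := d) hb)) ∧ ‖η‖ ≤ R} with hS
  have hsep : TopologicalSpace.IsSeparable S :=
    ((TopologicalSpace.isSeparable_range (continuous_dotFeature hb)).span (R := ℝ)).mono
      fun η hη => hη.1
  obtain ⟨T, hTS, hTc, hST⟩ := hsep.exists_countable_dense_subset
  -- `|B| + 1` is positive even when `B = 0`, as division by its square requires.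
  have hL' : IsLoss (|B| + 1) L := hL.mono (by linarith [le_abs_self B])
  have hev := measure_exists_deviation_le (D := D) (f := f) (R := R) (κ := 2 * κ) (t := ε / 4) hL'
    (by positivity) hfm (measurable_inner_dotFeature hb)
    (by simp only [norm_dotFeature_sq]; exact integrable_const _)
    (by simp only [norm_dotFeature_sq, integral_const]; simp; linarith) (by positivity)
    (by positivity) n hTc (fun η hη => (hTS hη).2)
  set E := {x : Fin n → UnitSphere d | ∃ η ∈ T,
        (∑ j, L (f (x j)) (inner ℝ η (dotFeature hb (x j)))) + (2 * R * √(n * (2 * κ)) + n * (ε / 4))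
          < n * ∫ y, L (f y) (inner ℝ η (dotFeature hb y)) ∂D} with hE
  calc failureProb (kernelLearner (dotKernel b)) L f D ε n
      ≤ ((Measure.pi fun _ : Fin n => D).prod ((kernelLearner (dotKernel b)).law n))
          (E ×ˢ Set.univ) := by
        refine measure_mono fun p hp => ?_
        refine Set.mk_mem_prod ?_ (Set.mem_univ _)
        by_contra hx
        apply hp
        obtain ⟨α, hα1, hα2, hα3⟩ := exists_kernelInterpolant_eq (inner_dotFeature hb) θ p.1
        change generalizationError L D f (kernelInterpolant _ _) < _
        simp only [hθ] at hα2 hα3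
        rw [hα3]
        set η := ∑ i, α i • dotFeature hb (p.1 i)
        refine generalizationError_lt hL hfm (measurable_inner_dotFeature hb η) hε ?_
        have hηS : η ∈ S := ⟨Submodule.sum_mem _ fun i _ => Submodule.smul_mem _ _
          (Submodule.subset_span ⟨_, rfl⟩), hα1.trans hθR⟩
        simp only [hE, Set.mem_ofPred_eq, not_exists, not_and, not_lt] at hx
        have := risk_le_of_mem_closure hL' hfm (measurable_inner_dotFeature hb) p.1 hx (hST hηS)
        simp only [hα2, hL.self_eq_zero, Finset.sum_const_zero, zero_add] at this
        have h2 := this.trans (deviation_le hκ hε hM hΛ h1 hn)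
        have hn0 : (0 : ℝ) < n := by exact_mod_cast hn1
        have h3 := le_of_mul_le_mul_left h2 hn0
        linarith
    _ = (Measure.pi fun _ : Fin n => D) E := by
        rw [Measure.prod_prod, measure_univ, mul_one]
    _ ≤ _ := hev
    _ < _ := (ENNReal.ofReal_lt_ofReal_iff hδ).2 (exp_neg_lt hκ hε hM hδ hδ1 h1 hn)

end KernelLearning

/-! ### Stochastic gradient descent on interpolable data -/

section SGD

variable {X : Type u} {W : Type w} {m n : ℕ} (φ : W → X → ℝ)

/-- The vector of activations of the hidden layer. -/
noncomputable def netFeature (ω : Fin m → W) (x : X) : EuclideanSpace ℝ (Fin m) :=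
  WithLp.toLp 2 (hiddenActivation φ ω x)

theorem networkOutput_eq_inner (ω : Fin m → W) (a : Fin m → ℝ) (x : X) :
    networkOutput φ ω a x = inner ℝ (WithLp.toLp 2 a) (netFeature φ ω x) := by
  simp [networkOutput, netFeature, PiLp.inner_apply, mul_comm]

/-- The output weights after `T` steps of stochastic gradient descent. -/
noncomputable def sgdWeights (η : ℝ) (data : Fin n → X × ℝ) (ω : Fin m → W) (T : ℕ)
    (r : Fin T → unitInterval) : Fin m → ℝ :=
  Fin.foldl T (fun a t => sgdStep φ η data ω a (r t)) 0

theorem sgdWeights_succ (η : ℝ) (data : Fin n → X × ℝ) (ω : Fin m → W) (T : ℕ)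
    (r : Fin (T + 1) → unitInterval) :
    sgdWeights φ η data ω (T + 1) r =
      sgdStep φ η data ω (sgdWeights φ η data ω T fun t => r t.castSucc) (r (Fin.last T)) := by
  rw [sgdWeights, Fin.foldl_succ_last]
  rfl

/-- Writing the random choice of example as a sum of indicators makes the step visibly measurable in
the seed. -/
theorem sgdStep_apply (η : ℝ) (data : Fin n → X × ℝ) (ω : Fin m → W) (a : Fin m → ℝ)
    (r : unitInterval) (i : Fin m) :
    sgdStep φ η data ω a r i = a i - ∑ j : Fin n, if ⌊(n : ℝ) * (r : ℝ)⌋₊ = j then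
      η * (networkOutput φ ω a (data j).1 - (data j).2) * hiddenActivation φ ω (data j).1 i
      else 0 := by
  rw [sgdStep]
  split_ifs with h
  · rw [Finset.sum_eq_single (⟨_, h⟩ : Fin n)]
    · simp
    · intro j _ hj
      rw [if_neg]
      intro e
      exact hj (Fin.ext e.symm)
    · simp
  · rw [Finset.sum_eq_zero, sub_zero]
    intro j _
    rw [if_neg]
    intro e
    exact h (e ▸ j.2)

/-- One step of gradient descent at an example decreases the distance to any interpolant. -/
theorem norm_sub_sgdStep_le {η : ℝ} (hη : 0 ≤ η) {data : Fin n → X × ℝ} {ω : Fin m → W}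
    (hs : ∀ j, η * ‖netFeature φ ω (data j).1‖ ^ 2 ≤ 1) {v : EuclideanSpace ℝ (Fin m)}
    (hv : ∀ j, inner ℝ v (netFeature φ ω (data j).1) = (data j).2) (a : Fin m → ℝ)
    (r : unitInterval) (j : Fin n) :
    ‖WithLp.toLp 2 (sgdStep φ η data ω a r) - v‖ ^ 2
        + (if ⌊(n : ℝ) * (r : ℝ)⌋₊ = j then
          η * (networkOutput φ ω a (data j).1 - (data j).2) ^ 2 else 0)
      ≤ ‖WithLp.toLp 2 a - v‖ ^ 2 := by
  by_cases h : ⌊(n : ℝ) * (r : ℝ)⌋₊ < n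
  · set k : Fin n := ⟨_, h⟩ with hk
    set ρ := networkOutput φ ω a (data k).1 - (data k).2 with hρ
    have e1 : WithLp.toLp 2 (sgdStep φ η data ω a r) - v =
        (WithLp.toLp 2 a - v) - (η * ρ) • netFeature φ ω (data k).1 := by
      rw [sgdStep, dif_pos h]
      ext i
      simp [netFeature, hρ, hk]
      ring
    have e2 : inner ℝ (WithLp.toLp 2 a - v) (netFeature φ ω (data k).1) = ρ := by
      rw [inner_sub_left, hv, ← networkOutput_eq_inner]
    have e3 : (if ⌊(n : ℝ) * (r : ℝ)⌋₊ = j then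
        η * (networkOutput φ ω a (data j).1 - (data j).2) ^ 2 else 0) ≤ η * ρ ^ 2 := by
      split_ifs with hj
      · have : j = k := Fin.ext hj.symm
        rw [this]
      · positivity
    -- The expansion is `‖a - v‖² - 2 η ρ² + η² ρ² ‖ψ‖²`, and `η ‖ψ‖² ≤ 1` absorbs half of the
    -- decrease.
    rw [e1, norm_sub_sq_real, inner_smul_right, e2, norm_smul, mul_pow, Real.norm_eq_abs, sq_abs]
    have e4 := mul_le_mul_of_nonneg_left (hs k) (mul_nonneg hη (sq_nonneg ρ))
    nlinarith
  · have hj : ⌊(n : ℝ) * (r : ℝ)⌋₊ ≠ j := fun e => h (e ▸ j.2)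
    rw [sgdStep, dif_neg h, if_neg hj, add_zero]

theorem norm_sub_sgdStep_le' {η : ℝ} (hη : 0 ≤ η) {data : Fin n → X × ℝ} {ω : Fin m → W}
    (hs : ∀ j, η * ‖netFeature φ ω (data j).1‖ ^ 2 ≤ 1) {v : EuclideanSpace ℝ (Fin m)}
    (hv : ∀ j, inner ℝ v (netFeature φ ω (data j).1) = (data j).2) (a : Fin m → ℝ)
    (r : unitInterval) :
    ‖WithLp.toLp 2 (sgdStep φ η data ω a r) - v‖ ≤ ‖WithLp.toLp 2 a - v‖ := by
  by_cases h : ⌊(n : ℝ) * (r : ℝ)⌋₊ < n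
  · have h1 := norm_sub_sgdStep_le φ hη hs hv a r ⟨_, h⟩
    refine le_of_sq_le_sq (le_trans (le_add_of_nonneg_right ?_) h1) (norm_nonneg _)
    split_ifs <;> positivity
  -- For `r = 1` or `n = 0` the index is out of range and the step does nothing.
  · rw [sgdStep, dif_neg h]

/-- The weights start at `0`, at distance `‖v‖` from `v`, and no step increases the distance. Hence
they stay in a ball of radius `2 ‖v‖`, whatever the number of steps. -/
theorem norm_sgdWeights_sub_le {η : ℝ} (hη : 0 ≤ η) {data : Fin n → X × ℝ} {ω : Fin m → W}
    (hs : ∀ j, η * ‖netFeature φ ω (data j).1‖ ^ 2 ≤ 1) {v : EuclideanSpace ℝ (Fin m)}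
    (hv : ∀ j, inner ℝ v (netFeature φ ω (data j).1) = (data j).2) (T : ℕ)
    (r : Fin T → unitInterval) :
    ‖WithLp.toLp 2 (sgdWeights φ η data ω T r) - v‖ ≤ ‖v‖ := by
  induction T with
  | zero =>
    have : WithLp.toLp 2 (sgdWeights φ η data ω 0 r) = 0 := by
      ext i
      simp [sgdWeights]
    rw [this, zero_sub, norm_neg]
  | succ T ih =>
    rw [sgdWeights_succ]
    exact (norm_sub_sgdStep_le' φ hη hs hv _ _).trans (ih _)

variable [MeasurableSpace X] [MeasurableSpace W] {φ}

section Measurability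

variable {Z : Type*} [MeasurableSpace Z]

theorem measurable_hiddenActivation (hφ : Measurable (Function.uncurry φ)) {ω : Z → Fin m → W}
    {x : Z → X} (hω : Measurable ω) (hx : Measurable x) (i : Fin m) :
    Measurable fun z => hiddenActivation φ (ω z) (x z) i :=
  (hφ.comp (((measurable_pi_apply i).comp hω).prodMk hx)).div_const _

theorem measurable_networkOutput (hφ : Measurable (Function.uncurry φ)) {ω : Z → Fin m → W}
    {a : Z → Fin m → ℝ} {x : Z → X} (hω : Measurable ω) (ha : Measurable a) (hx : Measurable x) :
    Measurable fun z => networkOutput φ (ω z) (a z) (x z) :=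
  Finset.measurable_sum _ fun i _ =>
    ((measurable_pi_apply i).comp ha).mul (measurable_hiddenActivation hφ hω hx i)

theorem measurable_netFeature (hφ : Measurable (Function.uncurry φ)) {ω : Z → Fin m → W}
    {x : Z → X} (hω : Measurable ω) (hx : Measurable x) :
    Measurable fun z => netFeature φ (ω z) (x z) :=
  (WithLp.measurable_toLp 2 _).comp
    (measurable_pi_lambda _ fun i => measurable_hiddenActivation hφ hω hx i)

theorem measurableSet_floor_eq {r : Z → unitInterval} (hr : Measurable r) (j : ℕ) :
    MeasurableSet {z | ⌊(n : ℝ) * (r z : ℝ)⌋₊ = j} :=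
  (Nat.measurable_floor.comp ((measurable_subtype_coe.comp hr).const_mul (n : ℝ)))
    (measurableSet_singleton j)

theorem measurable_sgdStep (hφ : Measurable (Function.uncurry φ)) (η : ℝ)
    {data : Z → Fin n → X × ℝ} {ω : Z → Fin m → W} {a : Z → Fin m → ℝ} {r : Z → unitInterval}
    (hdata : Measurable data) (hω : Measurable ω) (ha : Measurable a) (hr : Measurable r) :
    Measurable fun z => sgdStep φ η (data z) (ω z) (a z) (r z) := by
  refine measurable_pi_lambda _ fun i => ?_
  simp only [sgdStep_apply]
  refine ((measurable_pi_apply i).comp ha).sub (Finset.measurable_sum _ fun j _ => ?_)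
  have hd := (measurable_pi_apply j).comp hdata
  exact Measurable.ite (measurableSet_floor_eq hr j)
    ((((measurable_networkOutput hφ hω ha (measurable_fst.comp hd)).sub
      (measurable_snd.comp hd)).const_mul η).mul
      (measurable_hiddenActivation hφ hω (measurable_fst.comp hd) i)) measurable_const

theorem measurable_sgdWeights (hφ : Measurable (Function.uncurry φ)) (η : ℝ)
    {data : Z → Fin n → X × ℝ} {ω : Z → Fin m → W} (hdata : Measurable data) (hω : Measurable ω)
    (T : ℕ) {r : Z → Fin T → unitInterval} (hr : Measurable r) :
    Measurable fun z => sgdWeights φ η (data z) (ω z) T (r z) := by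
  induction T with
  | zero => exact measurable_const
  | succ T ih =>
    simp only [sgdWeights_succ]
    exact measurable_sgdStep hφ η hdata hω
      (ih (measurable_pi_lambda _ fun t => (measurable_pi_apply _).comp hr))
      ((measurable_pi_apply _).comp hr)

end Measurability

/-- The set contains the points of an interval of length `1 / n`. Positivity is enough: it gives
every example a fixed share of the expected decrease. -/
theorem volume_floor_eq_pos (j : Fin n) :
    volume {r : unitInterval | ⌊(n : ℝ) * (r : ℝ)⌋₊ = j} ≠ 0 := by
  have hn : (0 : ℝ) < n := by exact_mod_cast (Nat.zero_le _).trans_lt j.2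
  have hj : ((j : ℕ) : ℝ) + 1 ≤ n := by exact_mod_cast j.2
  have hsub : Set.Ioo ((j : ℝ) / n) ((j + 1) / n) ⊆
      Subtype.val '' {r : unitInterval | ⌊(n : ℝ) * (r : ℝ)⌋₊ = j} := by
    rintro x ⟨h1, h2⟩
    have h0 : 0 < x := lt_of_le_of_lt (by positivity) h1
    rw [div_lt_iff₀ hn] at h1
    rw [lt_div_iff₀ hn] at h2
    refine ⟨⟨x, h0.le, ?_⟩, ?_, rfl⟩
    · by_contra hx
      nlinarith
    · simp only [Set.mem_ofPred_eq]
      rw [Nat.floor_eq_iff (by positivity)]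
      constructor <;> linarith
  rw [unitInterval.volume_apply]
  refine (lt_of_lt_of_le ?_ (measure_mono hsub)).ne'
  rw [Real.volume_Ioo, ENNReal.ofReal_pos, ← sub_div]
  have : (j : ℝ) + 1 - j = 1 := by ring
  rw [this]
  positivity

/-- The mean squared residual of stochastic gradient descent at an example tends to zero. -/
theorem tendsto_lintegral_sgd_residual (hφ : Measurable (Function.uncurry φ)) {η : ℝ} (hη : 0 < η)
    {data : Fin n → X × ℝ} {ω : Fin m → W}
    (hs : ∀ j, η * ‖netFeature φ ω (data j).1‖ ^ 2 ≤ 1) {v : EuclideanSpace ℝ (Fin m)}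
    (hv : ∀ j, inner ℝ v (netFeature φ ω (data j).1) = (data j).2) (j : Fin n) :
    Filter.Tendsto (fun T => ∫⁻ r : Fin T → unitInterval, ENNReal.ofReal
        ((networkOutput φ ω (sgdWeights φ η data ω T r) (data j).1 - (data j).2) ^ 2)
          ∂(Measure.pi fun _ => volume)) Filter.atTop (nhds 0) := by
  set s : ℕ → ℝ≥0∞ := fun T => ∫⁻ r : Fin T → unitInterval, ENNReal.ofReal
        ((networkOutput φ ω (sgdWeights φ η data ω T r) (data j).1 - (data j).2) ^ 2)
          ∂(Measure.pi fun _ => volume) with hsdef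
  set V : ℕ → ℝ≥0∞ := fun T => ∫⁻ r : Fin T → unitInterval, ENNReal.ofReal
        (‖WithLp.toLp 2 (sgdWeights φ η data ω T r) - v‖ ^ 2) ∂(Measure.pi fun _ => volume) with hV
  set J : Set unitInterval := {r | ⌊(n : ℝ) * (r : ℝ)⌋₊ = j} with hJ
  have hJm : MeasurableSet J := measurableSet_floor_eq measurable_id j
  set c : ℝ≥0∞ := ENNReal.ofReal η * volume J with hc
  have hc0 : c ≠ 0 := mul_ne_zero (by simpa using hη) (volume_floor_eq_pos j)
  have hw : ∀ T, Measurable fun r : Fin T → unitInterval => sgdWeights φ η data ω T r := fun T =>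
    measurable_sgdWeights hφ η measurable_const measurable_const T measurable_id
  have hres : ∀ T, Measurable fun r : Fin T → unitInterval => ENNReal.ofReal
      ((networkOutput φ ω (sgdWeights φ η data ω T r) (data j).1 - (data j).2) ^ 2) := fun T =>
    ENNReal.measurable_ofReal.comp (((measurable_networkOutput hφ measurable_const (hw T)
      measurable_const).sub_const _).pow_const 2)
  -- The expected squared distance to `v` is a potential. The last seed is independent of the
  -- weights it acts on, so the expected decrease factors into `c` and the mean squared residual.
  have hstep : ∀ T, V (T + 1) + c * s T ≤ V T := fun T => by
    have hmp := measurePreserving_piFinSuccAbove (fun _ : Fin (T + 1) => (volume : Measure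
      unitInterval)) (Fin.last T)
    have e1 : V (T + 1) = ∫⁻ z : unitInterval × (Fin T → unitInterval), ENNReal.ofReal
        (‖WithLp.toLp 2 (sgdStep φ η data ω (sgdWeights φ η data ω T z.2) z.1) - v‖ ^ 2)
          ∂(volume.prod (Measure.pi fun _ => volume)) := by
      rw [hV]
      simp only
      rw [← (hmp.symm _).lintegral_comp_emb (MeasurableEquiv.measurableEmbedding _)]
      refine lintegral_congr fun z => ?_
      rw [sgdWeights_succ]
      simp
    have e2 : c * s T = ∫⁻ z : unitInterval × (Fin T → unitInterval),
        J.indicator (fun _ => ENNReal.ofReal η) z.1 * ENNReal.ofReal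
          ((networkOutput φ ω (sgdWeights φ η data ω T z.2) (data j).1 - (data j).2) ^ 2)
          ∂(volume.prod (Measure.pi fun _ => volume)) := by
      rw [lintegral_prod_mul (measurable_const.indicator hJm).aemeasurable (hres T).aemeasurable,
        lintegral_indicator_const hJm]
    have hm1 : Measurable fun z : unitInterval × (Fin T → unitInterval) => ENNReal.ofReal
        (‖WithLp.toLp 2 (sgdStep φ η data ω (sgdWeights φ η data ω T z.2) z.1) - v‖ ^ 2) := by
      refine ENNReal.measurable_ofReal.comp (Measurable.pow_const (Measurable.norm
        (Measurable.sub_const ?_ _)) 2)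
      exact (WithLp.measurable_toLp 2 _).comp (measurable_sgdStep hφ η measurable_const
        measurable_const ((hw T).comp measurable_snd) measurable_fst)
    have e3 : V T = ∫⁻ z : unitInterval × (Fin T → unitInterval), ENNReal.ofReal
        (‖WithLp.toLp 2 (sgdWeights φ η data ω T z.2) - v‖ ^ 2)
          ∂(volume.prod (Measure.pi fun _ => volume)) := by
      have hsnd := measurePreserving_snd (μ := (volume : Measure unitInterval))
        (ν := Measure.pi fun _ : Fin T => (volume : Measure unitInterval))
      rw [hV]
      refine (hsnd.lintegral_comp (f := fun r : Fin T → unitInterval => ENNReal.ofReal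
        (‖WithLp.toLp 2 (sgdWeights φ η data ω T r) - v‖ ^ 2)) ?_).symm
      exact ENNReal.measurable_ofReal.comp (Measurable.pow_const (Measurable.norm
        (((WithLp.measurable_toLp 2 _).comp (hw T)).sub_const _)) 2)
    rw [e1, e2, e3, ← lintegral_add_left hm1]
    refine lintegral_mono fun z => ?_
    have key := norm_sub_sgdStep_le φ hη.le hs hv (sgdWeights φ η data ω T z.2) z.1 j
    refine le_trans (le_of_eq ?_) (ENNReal.ofReal_le_ofReal key)
    rw [ENNReal.ofReal_add (by positivity) (by split_ifs <;> positivity)]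
    congr 1
    by_cases hz : ⌊(n : ℝ) * (z.1 : ℝ)⌋₊ = j
    · have hzJ : z.1 ∈ J := hz
      rw [Set.indicator_of_mem hzJ, ← ENNReal.ofReal_mul hη.le, if_pos hz]
    · have hzJ : z.1 ∉ J := hz
      rw [Set.indicator_of_notMem hzJ, if_neg hz, zero_mul, ENNReal.ofReal_zero]
  -- Telescoping bounds the sum of all mean squared residuals by `V 0 / c`, so they tend to zero.
  have hsum : ∀ T, V T + ∑ t ∈ Finset.range T, c * s t ≤ V 0 := fun T => by
    induction T with
    | zero => simp
    | succ T ih =>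
      rw [Finset.sum_range_succ]
      calc V (T + 1) + (∑ t ∈ Finset.range T, c * s t + c * s T)
          = (V (T + 1) + c * s T) + ∑ t ∈ Finset.range T, c * s t := by ring
        _ ≤ V T + ∑ t ∈ Finset.range T, c * s t := add_le_add_left (hstep T) _
        _ ≤ V 0 := ih
  have hV0 : V 0 ≠ ⊤ := by
    rw [hV]
    simp [sgdWeights]
  have hts : ∑' t, c * s t ≠ ⊤ := by
    refine ne_top_of_le_ne_top hV0 ?_
    rw [ENNReal.tsum_eq_iSup_nat]
    exact iSup_le fun T => le_trans le_add_self (hsum T)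
  rw [ENNReal.tsum_mul_left] at hts
  refine ENNReal.tendsto_atTop_zero_of_tsum_ne_top fun h => hts ?_
  rw [h, ENNReal.mul_top hc0]

/-- Stochastic gradient descent fits interpolable data with probability tending to one. -/
theorem tendsto_measure_sgd_residual (hφ : Measurable (Function.uncurry φ)) {η : ℝ} (hη : 0 < η)
    {data : Fin n → X × ℝ} {ω : Fin m → W}
    (hs : ∀ j, η * ‖netFeature φ ω (data j).1‖ ^ 2 ≤ 1) {v : EuclideanSpace ℝ (Fin m)}
    (hv : ∀ j, inner ℝ v (netFeature φ ω (data j).1) = (data j).2) {ρ : ℝ} (hρ : 0 < ρ) :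
    Filter.Tendsto (fun T => (Measure.pi fun _ : Fin T => (volume : Measure unitInterval))
        {r | ∃ j, ρ ≤ |networkOutput φ ω (sgdWeights φ η data ω T r) (data j).1 - (data j).2|})
      Filter.atTop (nhds 0) := by
  have hlim : Filter.Tendsto (fun T => ∑ j : Fin n, (∫⁻ r : Fin T → unitInterval, ENNReal.ofReal
        ((networkOutput φ ω (sgdWeights φ η data ω T r) (data j).1 - (data j).2) ^ 2)
          ∂(Measure.pi fun _ => volume)) / ENNReal.ofReal (ρ ^ 2)) Filter.atTop (nhds 0) := by
    rw [← Finset.sum_const_zero (s := (Finset.univ : Finset (Fin n)))]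
    refine tendsto_finsetSum _ fun j _ => ?_
    have := ENNReal.Tendsto.div_const (tendsto_lintegral_sgd_residual hφ hη hs hv j)
      (b := ENNReal.ofReal (ρ ^ 2)) (Or.inr (by positivity))
    rwa [ENNReal.zero_div] at this
  refine tendsto_of_tendsto_of_tendsto_of_le_of_le tendsto_const_nhds hlim (fun _ => zero_le)
    fun T => ?_
  have hun : {r : Fin T → unitInterval | ∃ j, ρ ≤
      |networkOutput φ ω (sgdWeights φ η data ω T r) (data j).1 - (data j).2|} ⊆
      ⋃ j : Fin n, {r | ENNReal.ofReal (ρ ^ 2) ≤ ENNReal.ofReal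
        ((networkOutput φ ω (sgdWeights φ η data ω T r) (data j).1 - (data j).2) ^ 2)} := by
    rintro r ⟨j, hj⟩
    refine Set.mem_iUnion.2 ⟨j, ENNReal.ofReal_le_ofReal ?_⟩
    rw [← sq_abs (networkOutput _ _ _ _ - _)]
    gcongr
  refine (measure_mono hun).trans ((measure_iUnion_le _).trans ?_)
  rw [tsum_fintype]
  refine Finset.sum_le_sum fun j _ => meas_ge_le_lintegral_div ?_ (by positivity)
    ENNReal.ofReal_ne_top
  exact (ENNReal.measurable_ofReal.comp (((measurable_networkOutput hφ measurable_const
    (measurable_sgdWeights hφ η measurable_const measurable_const T measurable_id)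
      measurable_const).sub_const _).pow_const 2)).aemeasurable

end SGD

/-! ### Random features approximate the kernel -/

/-! ### Interpolation under convergence of Gram matrices. -/

section GramInterpolation

variable {X : Type*} {E : Type*} [NormedAddCommGroup E] [InnerProductSpace ℝ E]

/-- If the Gram matrix is invertible, then any values are interpolated by a combination of the
features. -/
theorem exists_interpolant_of_det_gram_ne_zero {S : Type*} [Fintype S] [DecidableEq S] (ψ : S → E)
    (hG : (Matrix.gram ℝ ψ).det ≠ 0) (y : S → ℝ) :
    ∃ v : E, (∀ s, inner ℝ v (ψ s) = y s) ∧ v ∈ Submodule.span ℝ (Set.range ψ) ∧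
      ‖v‖ ^ 2 = ((Matrix.gram ℝ ψ)⁻¹.mulVec y) ⬝ᵥ y := by
  set α := (Matrix.gram ℝ ψ)⁻¹.mulVec y with hα
  have h1 : (Matrix.gram ℝ ψ).mulVec α = y := by
    rw [hα, Matrix.mulVec_mulVec, Matrix.mul_nonsing_inv _ (isUnit_iff_ne_zero.2 hG),
      Matrix.one_mulVec]
  have h2 : ∀ s, inner ℝ (∑ t, α t • ψ t) (ψ s) = y s := fun s => by
    rw [← congrFun h1 s, sum_inner]
    simp only [Matrix.mulVec, dotProduct, Matrix.gram_apply, inner_smul_left]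
    refine Finset.sum_congr rfl fun t _ => ?_
    rw [real_inner_comm, mul_comm]
    simp
  refine ⟨∑ t, α t • ψ t, h2, Submodule.sum_mem _ fun t _ => Submodule.smul_mem _ _
    (Submodule.subset_span ⟨t, rfl⟩), ?_⟩
  rw [← real_inner_self_eq_norm_sq, inner_sum]
  simp only [inner_smul_right, h2, dotProduct]

/-- `v` is the orthogonal projection of `θ` onto the span. -/
theorem norm_le_of_interpolant {S : Type*} {ψ : S → E} {v θ : E}
    (hv : v ∈ Submodule.span ℝ (Set.range ψ)) (h : ∀ s, inner ℝ v (ψ s) = inner ℝ θ (ψ s)) :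
    ‖v‖ ≤ ‖θ‖ := by
  have h1 : inner ℝ (v - θ) v = 0 := by
    refine Submodule.span_induction (p := fun u _ => inner ℝ (v - θ) u = 0) ?_ ?_ ?_ ?_ hv
    · rintro _ ⟨s, rfl⟩
      rw [inner_sub_left, h, sub_self]
    · exact inner_zero_right _
    · intro a b _ _ ha hb
      rw [inner_add_right, ha, hb, add_zero]
    · intro c a _ ha
      rw [inner_smul_right, ha, mul_zero]
  rw [inner_sub_left, sub_eq_zero, real_inner_self_eq_norm_sq] at h1
  have h3 := real_inner_le_norm θ v
  rw [← h1, sq] at h3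
  rcases (norm_nonneg v).eq_or_lt with h0 | h0
  · rw [← h0]
    exact norm_nonneg θ
  · exact le_of_mul_le_mul_right h3 h0

/-- If the Gram matrices of `ψ m` converge to that of `Φ`, then for large `m` there are interpolants
in the features `ψ m` whose norm is hardly larger than that of an interpolant in `Φ`. -/
theorem eventually_exists_interpolant {F : ℕ → Type*} [∀ m, NormedAddCommGroup (F m)]
    [∀ m, InnerProductSpace ℝ (F m)] {Φ : X → E} {n : ℕ} (x : Fin n → X)
    (hΦ : LinearIndependent ℝ fun s : Set.range x => Φ s) (ψ : ∀ m, X → F m)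
    (hlim : ∀ i j, Filter.Tendsto (fun m => inner ℝ (ψ m (x i)) (ψ m (x j))) Filter.atTop
      (nhds (inner ℝ (Φ (x i)) (Φ (x j))))) (θ : E) {R : ℝ} (hR : ‖θ‖ < R) :
    ∀ᶠ m in Filter.atTop, ∃ v : F m, ‖v‖ ≤ R ∧
      ∀ j, inner ℝ v (ψ m (x j)) = inner ℝ θ (Φ (x j)) := by
  classical
  -- Indexing by distinct points instead of examples keeps the Gram matrix invertible when examples
  -- repeat.
  have : Fintype (Set.range x) := Fintype.ofFinite _
  set y : Set.range x → ℝ := fun s => inner ℝ θ (Φ s) with hy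
  set G := Matrix.gram ℝ (fun s : Set.range x => Φ s) with hGdef
  set Gm : ℕ → Matrix (Set.range x) (Set.range x) ℝ := fun m =>
    Matrix.gram ℝ (fun s : Set.range x => ψ m s) with hGm
  have hG : G.det ≠ 0 := Matrix.det_gram_ne_zero_iff_linearIndependent.2 hΦ
  have hGlim : Filter.Tendsto Gm Filter.atTop (nhds G) := by
    refine tendsto_pi_nhds.2 fun s => tendsto_pi_nhds.2 fun t => ?_
    obtain ⟨_, i, rfl⟩ := s
    obtain ⟨_, j, rfl⟩ := t
    exact hlim i j
  have hdet : Filter.Tendsto (fun m => (Gm m).det) Filter.atTop (nhds G.det) :=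
    ((continuous_id.matrix_det).tendsto G).comp hGlim
  have hadj : Filter.Tendsto (fun m => (Gm m).adjugate) Filter.atTop (nhds G.adjugate) :=
    ((continuous_id.matrix_adjugate).tendsto G).comp hGlim
  have hinv : Filter.Tendsto (fun m => (Gm m)⁻¹) Filter.atTop (nhds G⁻¹) := by
    simp only [Matrix.inv_def, Ring.inverse_eq_inv']
    exact (hdet.inv₀ hG).smul hadj
  -- The squared norm of the least interpolant is the quadratic form of the inverse Gram matrix,
  -- which depends continuously on an invertible Gram matrix.
  have hq : Filter.Tendsto (fun m => ((Gm m)⁻¹.mulVec y) ⬝ᵥ y) Filter.atTop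
      (nhds ((G⁻¹.mulVec y) ⬝ᵥ y)) := by
    have hc : Continuous fun A : Matrix (Set.range x) (Set.range x) ℝ => (A.mulVec y) ⬝ᵥ y :=
      (continuous_id.matrix_mulVec continuous_const).dotProduct continuous_const
    exact (hc.tendsto _).comp hinv
  obtain ⟨v, hv1, hv2, hv3⟩ := exists_interpolant_of_det_gram_ne_zero _ hG y
  have hvθ : ‖v‖ ≤ ‖θ‖ := norm_le_of_interpolant hv2 hv1
  have hlt : (G⁻¹.mulVec y) ⬝ᵥ y < R ^ 2 := by
    rw [← hv3]
    exact pow_lt_pow_left₀ (hvθ.trans_lt hR) (norm_nonneg _) two_ne_zero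
  filter_upwards [hq.eventually_lt_const hlt, hdet.eventually_ne hG] with m hm1 hm2
  obtain ⟨z, hz1, -, hz3⟩ := exists_interpolant_of_det_gram_ne_zero _ hm2 y
  refine ⟨z, ?_, fun j => hz1 ⟨x j, j, rfl⟩⟩
  refine le_of_sq_le_sq ?_ ((norm_nonneg θ).trans hR.le)
  rw [hz3]
  exact hm1.le

end GramInterpolation

/-! ### Laws of large numbers for the hidden layer. -/

section RandomFeatures

theorem inner_netFeature {X : Type u} {W : Type w} {φ : W → X → ℝ} {m : ℕ} (ω : Fin m → W) (x x' : X) :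
    inner ℝ (netFeature φ ω x) (netFeature φ ω x') = (∑ i, φ (ω i) x * φ (ω i) x') / m := by
  simp only [netFeature, PiLp.inner_apply, hiddenActivation, Finset.sum_div]
  refine Finset.sum_congr rfl fun i _ => ?_
  rw [RCLike.inner_apply, conj_trivial, div_mul_div_comm, Real.mul_self_sqrt (Nat.cast_nonneg _),
    mul_comm]

variable {X : Type u} [MeasurableSpace X] {W : Type w} [MeasurableSpace W] {ν : Measure W}
  [IsProbabilityMeasure ν] {φ : W → X → ℝ}

theorem ae_tendsto_average {q : W → ℝ} (hq : Measurable q) (hint : Integrable q ν) :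
    ∀ᵐ ω ∂(Measure.infinitePi fun _ : ℕ => ν),
      Filter.Tendsto (fun m : ℕ => (∑ i : Fin m, q (ω i)) / m) Filter.atTop
        (nhds (∫ z, q z ∂ν)) := by
  have hmp := fun i : ℕ => measurePreserving_eval_infinitePi (fun _ : ℕ => ν) i
  have hindep := ProbabilityTheory.iIndepFun_infinitePi (P := fun _ : ℕ => ν)
    (X := fun _ => q) (fun _ => hq)
  have hid : ∀ i : ℕ, ProbabilityTheory.IdentDistrib (fun ω : ℕ → W => q (ω i))
      (fun ω => q (ω 0)) (Measure.infinitePi fun _ : ℕ => ν) (Measure.infinitePi fun _ : ℕ => ν) :=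
    fun i => by
      have : ProbabilityTheory.IdentDistrib (fun ω : ℕ → W => ω i) (fun ω => ω 0)
          (Measure.infinitePi fun _ : ℕ => ν) (Measure.infinitePi fun _ : ℕ => ν) :=
        ⟨(hmp i).measurable.aemeasurable, (hmp 0).measurable.aemeasurable, by
          rw [(hmp i).map_eq, (hmp 0).map_eq]⟩
      exact this.comp hq
  have h := ProbabilityTheory.strong_law_ae_real (fun i (ω : ℕ → W) => q (ω i))
    ((hmp 0).integrable_comp_of_integrable hint) (fun i j hij => hindep.indepFun hij) hid
  have hE : ∫ ω : ℕ → W, q (ω 0) ∂(Measure.infinitePi fun _ : ℕ => ν) = ∫ z, q z ∂ν := by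
    have e := integral_map (f := q) (hmp 0).measurable.aemeasurable
      (by rw [(hmp 0).map_eq]; exact hint.aestronglyMeasurable)
    rw [(hmp 0).map_eq] at e
    exact e.symm
  rw [hE] at h
  filter_upwards [h] with ω hω
  simpa only [Fin.sum_univ_eq_sum_range fun i => q (ω i)] using hω

/-- Layers of all widths become truncations of one infinite sequence of weights, so almost sure
limits apply to them. -/
theorem measurePreserving_restrict_infinitePi (m : ℕ) :
    MeasurePreserving (fun (ω : ℕ → W) (i : Fin m) => ω i) (Measure.infinitePi fun _ : ℕ => ν)
      (Measure.pi fun _ : Fin m => ν) := by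
  have hm : Measurable fun (ω : ℕ → W) (i : Fin m) => ω i :=
    measurable_pi_lambda _ fun i => measurable_pi_apply _
  refine ⟨hm, ?_⟩
  have hindep := (ProbabilityTheory.iIndepFun_infinitePi (P := fun _ : ℕ => ν)
    (X := fun _ => id) (fun _ => measurable_id)).precomp (g := fun i : Fin m => (i : ℕ))
      Fin.val_injective
  have h := (ProbabilityTheory.iIndepFun_iff_map_fun_eq_pi_map
    (f := fun (i : Fin m) (ω : ℕ → W) => ω i)
    (fun i => (measurable_pi_apply (i : ℕ)).aemeasurable)).1 hindep
  refine h.trans ?_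
  congr 1
  ext1 i
  exact (measurePreserving_eval_infinitePi (fun _ : ℕ => ν) (i : ℕ)).map_eq

/-- The hidden layer `ω` has bounded kernel at the examples and on average, and admits an
interpolant of `f` of norm at most `R`. -/
def IsGoodLayer {m n : ℕ} (φ : W → X → ℝ) (D : Measure X) (f : X → ℝ) (κ R : ℝ) (x : Fin n → X)
    (ω : Fin m → W) : Prop :=
  (∀ j, ‖netFeature φ ω (x j)‖ ^ 2 ≤ 2 * κ) ∧
  (∃ v : EuclideanSpace ℝ (Fin m), ‖v‖ ≤ R ∧ ∀ j, inner ℝ v (netFeature φ ω (x j)) = f (x j)) ∧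
  ∫⁻ y, ENNReal.ofReal (‖netFeature φ ω y‖ ^ 2) ∂D ≤ ENNReal.ofReal (2 * κ)

/-- Serves measurability: the uncountable existential becomes a countable one. Compactness of the
ball turns arbitrarily good approximate interpolants into an exact one. -/
theorem exists_interpolant_iff {E : Type*} [NormedAddCommGroup E] [InnerProductSpace ℝ E]
    [ProperSpace E] {R : ℝ} {c : Set E} (hcR : c ⊆ Metric.closedBall 0 R)
    (hRc : Metric.closedBall 0 R ⊆ closure c) {n : ℕ} (u : Fin n → E) (y : Fin n → ℝ) :
    (∃ v : E, ‖v‖ ≤ R ∧ ∀ j, inner ℝ v (u j) = y j) ↔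
      ∀ k : ℕ, ∃ v ∈ c, ‖fun j => inner ℝ v (u j) - y j‖ < 1 / ((k : ℝ) + 1) := by
  have hpi : Continuous fun (v : E) (j : Fin n) => inner ℝ v (u j) - y j :=
    continuous_pi fun j => (continuous_id.inner continuous_const).sub continuous_const
  have hcont : Continuous fun v : E => ‖fun j => inner ℝ v (u j) - y j‖ := hpi.norm
  constructor
  · rintro ⟨v, hvR, hv⟩ k
    have hk : (0 : ℝ) < 1 / ((k : ℝ) + 1) := by positivity
    have hvc : v ∈ closure c := hRc (by simpa using hvR)
    have hopen : IsOpen {v : E | ‖fun j => inner ℝ v (u j) - y j‖ < 1 / ((k : ℝ) + 1)} :=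
      isOpen_lt hcont continuous_const
    obtain ⟨z, hz1, hz2⟩ := mem_closure_iff.1 hvc _ hopen (by
      have : (fun j => inner ℝ v (u j) - y j) = 0 := by
        ext j
        simp [hv]
      simpa only [Set.mem_ofPred_eq, this, norm_zero] using hk)
    exact ⟨z, hz2, hz1⟩
  · intro h
    have hne : (Metric.closedBall (0 : E) R).Nonempty := by
      obtain ⟨v, hv, -⟩ := h 0
      exact ⟨v, hcR hv⟩
    obtain ⟨v, hvR, hmin⟩ := (isCompact_closedBall (0 : E) R).exists_isMinOn hne hcont.continuousOn
    refine ⟨v, by simpa using hvR, ?_⟩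
    have h0 : ‖fun j => inner ℝ v (u j) - y j‖ ≤ 0 := by
      refine ge_of_tendsto' tendsto_one_div_add_atTop_nhds_zero_nat fun k => ?_
      obtain ⟨z, hz, hzk⟩ := h k
      exact (hmin (hcR hz)).trans hzk.le
    intro j
    have := congrFun (norm_le_zero_iff.1 h0) j
    exact sub_eq_zero.1 this

theorem measurableSet_isGoodLayer {m n : ℕ} (hφ : Measurable (Function.uncurry φ)) {D : Measure X}
    [IsProbabilityMeasure D] {f : X → ℝ} (hf : Measurable f) (κ R : ℝ) :
    MeasurableSet {z : (Fin n → X) × (Fin m → W) | IsGoodLayer φ D f κ R z.1 z.2} := by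
  have hx : ∀ j : Fin n, Measurable fun z : (Fin n → X) × (Fin m → W) => z.1 j := fun j =>
    (measurable_pi_apply j).comp measurable_fst
  have hψ : ∀ j : Fin n, Measurable fun z : (Fin n → X) × (Fin m → W) =>
      netFeature φ z.2 (z.1 j) := fun j => measurable_netFeature hφ measurable_snd (hx j)
  obtain ⟨c, hcR, hcc, hRc⟩ := (TopologicalSpace.IsSeparable.of_separableSpace
    (Metric.closedBall (0 : EuclideanSpace ℝ (Fin m)) R)).exists_countable_dense_subset
  have hset : {z : (Fin n → X) × (Fin m → W) | IsGoodLayer φ D f κ R z.1 z.2} =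
      (⋂ j, {z | ‖netFeature φ z.2 (z.1 j)‖ ^ 2 ≤ 2 * κ}) ∩
      ((⋂ k : ℕ, ⋃ v ∈ c, {z |
        ‖fun j => inner ℝ v (netFeature φ z.2 (z.1 j)) - f (z.1 j)‖ < 1 / ((k : ℝ) + 1)}) ∩
      {z | ∫⁻ y, ENNReal.ofReal (‖netFeature φ z.2 y‖ ^ 2) ∂D ≤ ENNReal.ofReal (2 * κ)}) := by
    ext z
    simp only [IsGoodLayer, exists_interpolant_iff hcR hRc, Set.mem_ofPred_eq, Set.mem_inter_iff,
      Set.mem_iInter, Set.mem_iUnion, exists_prop]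
  rw [hset]
  refine MeasurableSet.inter (MeasurableSet.iInter fun j =>
    measurableSet_le ((hψ j).norm.pow_const 2) measurable_const) (MeasurableSet.inter
    (MeasurableSet.iInter fun k => MeasurableSet.biUnion hcc fun v _ =>
      measurableSet_lt (Measurable.norm ?_) measurable_const) (measurableSet_le ?_ measurable_const))
  · exact measurable_pi_lambda _ fun j => (measurable_const.inner (hψ j)).sub (hf.comp (hx j))
  · have h1 : Measurable fun z : (Fin m → W) × X => ENNReal.ofReal (‖netFeature φ z.1 z.2‖ ^ 2) :=
      ENNReal.measurable_ofReal.comp ((measurable_netFeature hφ measurable_fst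
        measurable_snd).norm.pow_const 2)
    exact h1.lintegral_prod_right'.comp measurable_snd

variable {K : X → X → ℝ} {H : Type*} [NormedAddCommGroup H] [InnerProductSpace ℝ H] {Φ : X → H}
  {κ : ℝ} {D : Measure X} [IsProbabilityMeasure D]

/-- By Tonelli the left side is an average of independent copies of `∫ φ(w, y)² dD(y)`, whose mean
is `κ`. Random features need not be bounded uniformly in `y`; the deviation bound only asks for this
second moment. -/
theorem ae_eventually_lintegral_netFeature_le (hφ : HasHiddenKernel ν φ K)
    (hκ : ∀ x, K x x = κ) (hκ0 : 0 < κ) :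
    ∀ᵐ ω ∂(Measure.infinitePi fun _ : ℕ => ν), ∀ᶠ m : ℕ in Filter.atTop,
      ∫⁻ y, ENNReal.ofReal (‖netFeature φ (fun i : Fin m => ω i) y‖ ^ 2) ∂D
        ≤ ENNReal.ofReal (2 * κ) := by
  have hm : Measurable fun z : W × X => ENNReal.ofReal (φ z.1 z.2 ^ 2) :=
    ENNReal.measurable_ofReal.comp (hφ.measurable.pow_const 2)
  have hq : Measurable fun z => ∫⁻ y, ENNReal.ofReal (φ z y ^ 2) ∂D := hm.lintegral_prod_right'
  have htot : ∫⁻ z, ∫⁻ y, ENNReal.ofReal (φ z y ^ 2) ∂D ∂ν = ENNReal.ofReal κ := by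
    rw [lintegral_lintegral_swap hm.aemeasurable]
    have : ∀ y, ∫⁻ z, ENNReal.ofReal (φ z y ^ 2) ∂ν = ENNReal.ofReal κ := fun y => by
      rw [← ofReal_integral_eq_lintegral_ofReal (hφ.memLp y).integrable_sq
        (Filter.Eventually.of_forall fun z => sq_nonneg _), ← hκ y, ← hφ.kernel_eq]
      simp only [sq]
    simp [this]
  have hfin : ∀ᵐ z ∂ν, ∫⁻ y, ENNReal.ofReal (φ z y ^ 2) ∂D < ⊤ :=
    ae_lt_top hq (by rw [htot]; exact ENNReal.ofReal_ne_top)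
  have hlln := ae_tendsto_average hq.ennreal_toReal
    (integrable_toReal_of_lintegral_ne_top hq.aemeasurable
      (by rw [htot]; exact ENNReal.ofReal_ne_top))
  rw [integral_toReal hq.aemeasurable hfin, htot, ENNReal.toReal_ofReal hκ0.le] at hlln
  have hall : ∀ᵐ ω ∂(Measure.infinitePi fun _ : ℕ => ν), ∀ i : ℕ,
      ∫⁻ y, ENNReal.ofReal (φ (ω i) y ^ 2) ∂D < ⊤ := ae_all_iff.2 fun i =>
    (measurePreserving_eval_infinitePi (fun _ : ℕ => ν) i).quasiMeasurePreserving.ae hfin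
  filter_upwards [hlln, hall] with ω h1 h2
  filter_upwards [h1.eventually_le_const (by linarith : κ < 2 * κ)] with m hle
  refine le_trans (le_of_eq ?_) (ENNReal.ofReal_le_ofReal hle)
  have e1 : ∀ y, ENNReal.ofReal (‖netFeature φ (fun i : Fin m => ω i) y‖ ^ 2) =
      ∑ i : Fin m, ENNReal.ofReal (m : ℝ)⁻¹ * ENNReal.ofReal (φ (ω i) y ^ 2) := fun y => by
    rw [← real_inner_self_eq_norm_sq, inner_netFeature, div_eq_inv_mul,
      ENNReal.ofReal_mul (by positivity), ENNReal.ofReal_sum_of_nonneg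
      (fun i _ => mul_self_nonneg _), Finset.mul_sum]
    simp only [sq]
  have hmeas : ∀ i : ℕ, Measurable fun y => ENNReal.ofReal (φ (ω i) y ^ 2) := fun i =>
    hm.comp measurable_prodMk_left
  simp_rw [e1]
  rw [lintegral_finsetSum _ fun (i : Fin m) _ => (hmeas i).const_mul _]
  simp_rw [lintegral_const_mul _ (hmeas _)]
  rw [← Finset.mul_sum, div_eq_inv_mul, ENNReal.ofReal_mul (by positivity),
    ENNReal.ofReal_sum_of_nonneg fun i _ => ENNReal.toReal_nonneg]
  congr 1
  exact Finset.sum_congr rfl fun i _ => (ENNReal.ofReal_toReal (h2 i).ne).symm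

theorem ae_eventually_isGoodLayer (hφ : HasHiddenKernel ν φ K)
    (hΦ : ∀ x x', inner ℝ (Φ x) (Φ x') = K x x') (hκ : ∀ x, K x x = κ) (hκ0 : 0 < κ) {θ : H}
    {f : X → ℝ} (hθ : ∀ x, inner ℝ θ (Φ x) = f x) {R : ℝ} (hR : ‖θ‖ < R) {n : ℕ} (x : Fin n → X)
    (hind : LinearIndependent ℝ fun s : Set.range x => Φ s) :
    ∀ᵐ ω ∂(Measure.infinitePi fun _ : ℕ => ν), ∀ᶠ m : ℕ in Filter.atTop,
      IsGoodLayer φ D f κ R x fun i : Fin m => ω i := by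
  have hφx : ∀ x, Measurable fun ω => φ ω x := fun x =>
    hφ.measurable.comp measurable_prodMk_right
  have hlln : ∀ᵐ ω ∂(Measure.infinitePi fun _ : ℕ => ν), ∀ i j,
      Filter.Tendsto (fun m : ℕ => inner ℝ (netFeature φ (fun k : Fin m => ω k) (x i))
        (netFeature φ (fun k : Fin m => ω k) (x j))) Filter.atTop (nhds (K (x i) (x j))) := by
    refine ae_all_iff.2 fun i => ae_all_iff.2 fun j => ?_
    simp only [inner_netFeature]
    rw [← hφ.kernel_eq]
    exact ae_tendsto_average ((hφx _).mul (hφx _)) ((hφ.memLp (x i)).integrable_mul (hφ.memLp (x j)))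
  filter_upwards [hlln, ae_eventually_lintegral_netFeature_le (D := D) hφ hκ hκ0] with ω h1 h2
  have h3 := eventually_exists_interpolant x hind
    (fun m => netFeature φ (fun k : Fin m => ω k)) (by simpa only [hΦ] using h1) θ hR
  have h4 : ∀ᶠ m : ℕ in Filter.atTop, ∀ j,
      ‖netFeature φ (fun k : Fin m => ω k) (x j)‖ ^ 2 ≤ 2 * κ := by
    refine Filter.eventually_all.2 fun j => ?_
    have := h1 j j
    simp only [real_inner_self_eq_norm_sq, hκ] at this
    exact this.eventually_le_const (by linarith)
  filter_upwards [h2, h3, h4] with m e2 e3 e4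
  exact ⟨e4, by simpa only [hθ] using e3, e2⟩

/-- Wide hidden layers are good with probability tending to one. -/
theorem tendsto_measure_not_isGoodLayer (hφ : HasHiddenKernel ν φ K)
    (hΦ : ∀ x x', inner ℝ (Φ x) (Φ x') = K x x') (hκ : ∀ x, K x x = κ) (hκ0 : 0 < κ) {θ : H}
    {f : X → ℝ} (hf : Measurable f) (hθ : ∀ x, inner ℝ θ (Φ x) = f x) {R : ℝ} (hR : ‖θ‖ < R)
    (n : ℕ) (hind : ∀ x : Fin n → X, LinearIndependent ℝ fun s : Set.range x => Φ s) :
    Filter.Tendsto (fun m : ℕ => ((Measure.pi fun _ : Fin n => D).prod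
      (Measure.pi fun _ : Fin m => ν)) {z | ¬ IsGoodLayer φ D f κ R z.1 z.2})
      Filter.atTop (nhds 0) := by
  have hgood := fun m : ℕ => measurableSet_isGoodLayer (n := n) (m := m) hφ.measurable (D := D) hf κ R
  have hbad : ∀ m : ℕ, MeasurableSet {z : (Fin n → X) × (Fin m → W) |
      ¬ IsGoodLayer φ D f κ R z.1 z.2} := fun m => (hgood m).compl
  -- Dominated convergence is used twice: over the examples, and for fixed examples over the
  -- infinite sequence of hidden weights, where the bad events almost surely cease.
  simp_rw [Measure.prod_apply (hbad _)]
  rw [← lintegral_zero (μ := Measure.pi fun _ : Fin n => D)]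
  refine tendsto_lintegral_of_dominated_convergence (fun _ => 1)
    (fun m => measurable_measure_prodMk_left (hbad m))
    (fun m => Filter.Eventually.of_forall fun x => prob_le_one) (by simp)
    (Filter.Eventually.of_forall fun x => ?_)
  have hbx : ∀ m : ℕ, MeasurableSet {ω : Fin m → W | ¬ IsGoodLayer φ D f κ R x ω} := fun m =>
    measurable_prodMk_left (hbad m)
  have hmp := fun m : ℕ => measurePreserving_restrict_infinitePi (ν := ν) m
  have e1 : ∀ m : ℕ, (Measure.pi fun _ : Fin m => ν) {ω | ¬ IsGoodLayer φ D f κ R x ω} =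
      ∫⁻ ω, Set.indicator ((fun (ω : ℕ → W) (i : Fin m) => ω i) ⁻¹'
        {ω | ¬ IsGoodLayer φ D f κ R x ω}) (fun _ => (1 : ℝ≥0∞)) ω ∂(Measure.infinitePi fun _ : ℕ => ν) := fun m => by
    rw [lintegral_indicator_const ((hmp m).measurable (hbx m)), one_mul,
      (hmp m).measure_preimage (hbx m).nullMeasurableSet]
  change Filter.Tendsto (fun m : ℕ => (Measure.pi fun _ : Fin m => ν)
    {ω | ¬ IsGoodLayer φ D f κ R x ω}) Filter.atTop (nhds 0)
  simp_rw [e1]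
  rw [← lintegral_zero (μ := Measure.infinitePi fun _ : ℕ => ν)]
  refine tendsto_lintegral_of_dominated_convergence (fun _ => 1)
    (fun m => measurable_const.indicator ((hmp m).measurable (hbx m)))
    (fun m => Filter.Eventually.of_forall fun ω => ?_) (by simp) ?_
  · exact Set.indicator_le_self' (fun _ _ => zero_le) ω
  · filter_upwards [ae_eventually_isGoodLayer (D := D) hφ hΦ hκ hκ0 hθ hR x (hind x)] with ω hω
    refine tendsto_const_nhds.congr' ?_
    filter_upwards [hω] with m hm
    rw [Set.indicator_of_notMem]
    exact not_not.2 hm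

end RandomFeatures

/-! ### Networks trained by stochastic gradient descent -/

section NetworkLearning

theorem sgdWeights_zero_examples {X : Type u} {W : Type w} {m : ℕ} (φ : W → X → ℝ) (η : ℝ)
    (data : Fin 0 → X × ℝ) (ω : Fin m → W) (T : ℕ) (r : Fin T → unitInterval) :
    sgdWeights φ η data ω T r = 0 := by
  induction T with
  | zero => rfl
  | succ T ih =>
    ext i
    rw [sgdWeights_succ, sgdStep_apply, ih]
    simp

variable {X : Type u} [MeasurableSpace X] {W : Type w} [MeasurableSpace W] {ν : Measure W}
  [IsProbabilityMeasure ν] {φ : W → X → ℝ} {D : Measure X} [IsProbabilityMeasure D]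
  {B κ : ℝ} {L : ℝ → ℝ → ℝ} {f : X → ℝ} {m : ℕ}

/-- The uniform deviation bound for the output weights, jointly over examples and hidden layers. -/
theorem measure_prod_deviation_le {R t : ℝ} (hφ : Measurable (Function.uncurry φ))
    (hL : IsLoss B L) (hB0 : 0 < B) (hf : Measurable f) (hκ0 : 0 < κ) (ht : 0 < t) (n : ℕ)
    {c : Set (EuclideanSpace ℝ (Fin m))} (hc : c.Countable) (hR : ∀ v ∈ c, ‖v‖ ≤ R) :
    ((Measure.pi fun _ : Fin n => D).prod (Measure.pi fun _ : Fin m => ν))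
      {z | ∫⁻ y, ENNReal.ofReal (‖netFeature φ z.2 y‖ ^ 2) ∂D ≤ ENNReal.ofReal κ ∧ ∃ v ∈ c,
        (∑ j, L (f (z.1 j)) (inner ℝ v (netFeature φ z.2 (z.1 j)))) + (2 * R * √(n * κ) + n * t)
          < n * ∫ y, L (f y) (inner ℝ v (netFeature φ z.2 y)) ∂D}
      ≤ ENNReal.ofReal (Real.exp (-(2 * n * t ^ 2 / B ^ 2))) := by
  have hψ : ∀ ω : Fin m → W, Measurable (netFeature φ ω) := fun ω =>
    measurable_netFeature hφ measurable_const measurable_id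
  have hx : ∀ j : Fin n, Measurable fun z : (Fin n → X) × (Fin m → W) => z.1 j := fun j =>
    (measurable_pi_apply j).comp measurable_fst
  have hmeas : MeasurableSet {z : (Fin n → X) × (Fin m → W) |
      ∫⁻ y, ENNReal.ofReal (‖netFeature φ z.2 y‖ ^ 2) ∂D ≤ ENNReal.ofReal κ ∧ ∃ v ∈ c,
        (∑ j, L (f (z.1 j)) (inner ℝ v (netFeature φ z.2 (z.1 j)))) + (2 * R * √(n * κ) + n * t)
          < n * ∫ y, L (f y) (inner ℝ v (netFeature φ z.2 y)) ∂D} := by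
    have hset : {z : (Fin n → X) × (Fin m → W) |
        ∫⁻ y, ENNReal.ofReal (‖netFeature φ z.2 y‖ ^ 2) ∂D ≤ ENNReal.ofReal κ ∧ ∃ v ∈ c,
          (∑ j, L (f (z.1 j)) (inner ℝ v (netFeature φ z.2 (z.1 j)))) + (2 * R * √(n * κ) + n * t)
            < n * ∫ y, L (f y) (inner ℝ v (netFeature φ z.2 y)) ∂D} =
        {z | ∫⁻ y, ENNReal.ofReal (‖netFeature φ z.2 y‖ ^ 2) ∂D ≤ ENNReal.ofReal κ} ∩
        ⋃ v ∈ c, {z |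
          (∑ j, L (f (z.1 j)) (inner ℝ v (netFeature φ z.2 (z.1 j)))) + (2 * R * √(n * κ) + n * t)
            < n * ∫ y, L (f y) (inner ℝ v (netFeature φ z.2 y)) ∂D} := by
      ext z
      simp only [Set.mem_ofPred_eq, Set.mem_inter_iff, Set.mem_iUnion, exists_prop]
    rw [hset]
    refine MeasurableSet.inter (measurableSet_le ?_ measurable_const)
      (MeasurableSet.biUnion hc fun v _ => measurableSet_lt ?_ (Measurable.const_mul ?_ _))
    · have h1 : Measurable fun z : (Fin m → W) × X =>
          ENNReal.ofReal (‖netFeature φ z.1 z.2‖ ^ 2) :=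
        ENNReal.measurable_ofReal.comp ((measurable_netFeature hφ measurable_fst
          measurable_snd).norm.pow_const 2)
      exact h1.lintegral_prod_right'.comp measurable_snd
    · refine Measurable.add_const (Finset.measurable_sum _ fun j _ => ?_) _
      exact hL.measurable.comp ((hf.comp (hx j)).prodMk
        (measurable_const.inner (measurable_netFeature hφ measurable_snd (hx j))))
    · have h1 : StronglyMeasurable fun z : (Fin m → W) × X =>
          L (f z.2) (inner ℝ v (netFeature φ z.1 z.2)) :=
        (hL.measurable.comp ((hf.comp measurable_snd).prodMk
          (measurable_const.inner
            (measurable_netFeature hφ measurable_fst measurable_snd)))).stronglyMeasurable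
      exact h1.integral_prod_right'.measurable.comp measurable_snd
  -- The hidden layer is independent of the examples, so it can be frozen. The features are then
  -- deterministic, and a layer violating the moment bound has an empty section.
  rw [Measure.prod_apply_symm hmeas]
  refine (lintegral_mono (g := fun _ => ENNReal.ofReal (Real.exp (-(2 * n * t ^ 2 / B ^ 2))))
    fun ω => ?_).trans (by simp)
  by_cases hω : ∫⁻ y, ENNReal.ofReal (‖netFeature φ ω y‖ ^ 2) ∂D ≤ ENNReal.ofReal κ
  · have hnn : 0 ≤ᵐ[D] fun y => ‖netFeature φ ω y‖ ^ 2 :=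
      Filter.Eventually.of_forall fun y => sq_nonneg _
    have hsm : AEStronglyMeasurable (fun y => ‖netFeature φ ω y‖ ^ 2) D :=
      ((hψ ω).norm.pow_const 2).aestronglyMeasurable
    have hint : Integrable (fun y => ‖netFeature φ ω y‖ ^ 2) D :=
      (lintegral_ofReal_ne_top_iff_integrable hsm hnn).1
        (ne_top_of_le_ne_top ENNReal.ofReal_ne_top hω)
    have hle : ∫ y, ‖netFeature φ ω y‖ ^ 2 ∂D ≤ κ := by
      rw [integral_eq_lintegral_of_nonneg_ae hnn hsm]
      exact ENNReal.toReal_le_of_le_ofReal hκ0.le hω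
    refine (measure_mono ?_).trans (measure_exists_deviation_le (D := D) (f := f) (Ψ := netFeature φ ω)
      hL hB0 hf (fun v => measurable_const.inner (hψ ω)) hint hle hκ0 ht n hc hR)
    exact fun x hx => hx.2
  · have : (fun x : Fin n → X => (x, ω)) ⁻¹' {z : (Fin n → X) × (Fin m → W) |
        ∫⁻ y, ENNReal.ofReal (‖netFeature φ z.2 y‖ ^ 2) ∂D ≤ ENNReal.ofReal κ ∧ ∃ v ∈ c,
          (∑ j, L (f (z.1 j)) (inner ℝ v (netFeature φ z.2 (z.1 j)))) + (2 * R * √(n * κ) + n * t)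
            < n * ∫ y, L (f y) (inner ℝ v (netFeature φ z.2 y)) ∂D} = ∅ :=
      Set.eq_empty_of_forall_notMem fun x hx => hω hx.1
    rw [this, measure_empty]
    exact zero_le

/-- For good hidden layers, stochastic gradient descent fits the examples with probability tending
to one. -/
theorem tendsto_measure_good_and_residual (hφ : Measurable (Function.uncurry φ))
    (hf : Measurable f) {R η ρ : ℝ} (hη : 0 < η) (hηκ : η * (2 * κ) ≤ 1)
    (hρ : 0 < ρ) (n : ℕ) :
    Filter.Tendsto (fun T => (((Measure.pi fun _ : Fin n => D).prod
        (Measure.pi fun _ : Fin m => ν)).prod (Measure.pi fun _ : Fin T => volume))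
        {p : ((Fin n → X) × (Fin m → W)) × (Fin T → unitInterval) |
          IsGoodLayer φ D f κ R p.1.1 p.1.2 ∧ ∃ j, ρ ≤ |networkOutput φ p.1.2
            (sgdWeights φ η (fun i => (p.1.1 i, f (p.1.1 i))) p.1.2 T p.2) (p.1.1 j)
              - f (p.1.1 j)|})
      Filter.atTop (nhds 0) := by
  have hmeas : ∀ T, MeasurableSet {p : ((Fin n → X) × (Fin m → W)) × (Fin T → unitInterval) |
          IsGoodLayer φ D f κ R p.1.1 p.1.2 ∧ ∃ j, ρ ≤ |networkOutput φ p.1.2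
            (sgdWeights φ η (fun i => (p.1.1 i, f (p.1.1 i))) p.1.2 T p.2) (p.1.1 j)
              - f (p.1.1 j)|} := fun T => by
    have hset : {p : ((Fin n → X) × (Fin m → W)) × (Fin T → unitInterval) |
          IsGoodLayer φ D f κ R p.1.1 p.1.2 ∧ ∃ j, ρ ≤ |networkOutput φ p.1.2
            (sgdWeights φ η (fun i => (p.1.1 i, f (p.1.1 i))) p.1.2 T p.2) (p.1.1 j)
              - f (p.1.1 j)|} =
        (Prod.fst ⁻¹' {z : (Fin n → X) × (Fin m → W) | IsGoodLayer φ D f κ R z.1 z.2}) ∩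
        ⋃ j, {p | ρ ≤ |networkOutput φ p.1.2
            (sgdWeights φ η (fun i => (p.1.1 i, f (p.1.1 i))) p.1.2 T p.2) (p.1.1 j)
              - f (p.1.1 j)|} := by
      ext p
      simp only [Set.mem_ofPred_eq, Set.mem_inter_iff, Set.mem_iUnion, Set.mem_preimage]
    rw [hset]
    refine MeasurableSet.inter (measurable_fst (measurableSet_isGoodLayer hφ hf κ R))
      (MeasurableSet.iUnion fun j => measurableSet_le measurable_const ?_)
    have hx : ∀ j : Fin n, Measurable fun p : ((Fin n → X) × (Fin m → W)) × (Fin T → unitInterval)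
        => p.1.1 j := fun j => (measurable_pi_apply j).comp (measurable_fst.comp measurable_fst)
    have hω : Measurable fun p : ((Fin n → X) × (Fin m → W)) × (Fin T → unitInterval) => p.1.2 :=
      measurable_snd.comp measurable_fst
    exact ((measurable_networkOutput hφ hω (measurable_sgdWeights hφ η
      (measurable_pi_lambda _ fun i => (hx i).prodMk (hf.comp (hx i))) hω T measurable_snd)
        (hx j)).sub (hf.comp (hx j))).abs
  simp_rw [Measure.prod_apply (hmeas _)]
  rw [← lintegral_zero (μ := (Measure.pi fun _ : Fin n => D).prod (Measure.pi fun _ : Fin m => ν))]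
  refine tendsto_lintegral_of_dominated_convergence (fun _ => 1)
    (fun T => measurable_measure_prodMk_left (hmeas T))
    (fun T => Filter.Eventually.of_forall fun z => prob_le_one) (by simp)
    (Filter.Eventually.of_forall fun z => ?_)
  -- Convergence is pointwise in the examples and the layer, without a uniform rate; dominated
  -- convergence makes up for this.
  by_cases hz : IsGoodLayer φ D f κ R z.1 z.2
  · obtain ⟨h1, ⟨v, -, hv⟩, -⟩ := id hz
    refine tendsto_of_tendsto_of_tendsto_of_le_of_le tendsto_const_nhds
      (tendsto_measure_sgd_residual (φ := φ) (ω := z.2) (data := fun i => (z.1 i, f (z.1 i))) hφ hη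
        (fun j => ?_) (v := v) hv hρ) (fun _ => zero_le) fun T => measure_mono fun r hr => hr.2
    exact (mul_le_mul_of_nonneg_left (h1 j) hη.le).trans hηκ
  · refine tendsto_const_nhds.congr fun T => ?_
    symm
    refine measure_mono_null (t := ∅) (fun r hr => hz hr.1) measure_empty

/-- A good hidden layer with small residuals and small deviations generalizes. -/
theorem generalizationError_sgd_lt {R s ε : ℝ} {n T : ℕ} (hφ : Measurable (Function.uncurry φ))
    (hL : IsLoss B L) (hf : Measurable f) {η : ℝ} (hη : 0 < η) (hηκ : η * (2 * κ) ≤ 1)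
    (hε : 0 < ε) (hn : 0 < n) (hs : s ≤ n * (ε / 2)) {x : Fin n → X} {ω : Fin m → W}
    {r : Fin T → unitInterval} (hgood : IsGoodLayer φ D f κ R x ω)
    {c : Set (EuclideanSpace ℝ (Fin m))} (hc : Metric.closedBall 0 (2 * R) ⊆ closure c)
    (hdev : ∀ v ∈ c, n * ∫ y, L (f y) (inner ℝ v (netFeature φ ω y)) ∂D
      ≤ (∑ j, L (f (x j)) (inner ℝ v (netFeature φ ω (x j)))) + s)
    (hres : ∀ j, |networkOutput φ ω (sgdWeights φ η (fun i => (x i, f (x i))) ω T r) (x j)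
      - f (x j)| < ε / 4) :
    generalizationError L D f
      (networkOutput φ ω (sgdWeights φ η (fun i => (x i, f (x i))) ω T r))
      < ENNReal.ofReal ε := by
  obtain ⟨h1, ⟨v, hvR, hv⟩, -⟩ := hgood
  have hψ : Measurable (netFeature φ ω) := measurable_netFeature hφ measurable_const measurable_id
  set a := sgdWeights φ η (fun i => (x i, f (x i))) ω T r with ha
  have hnorm := norm_sgdWeights_sub_le φ hη.le (data := fun i => (x i, f (x i))) (ω := ω)
    (fun j => (mul_le_mul_of_nonneg_left (h1 j) hη.le).trans hηκ) (v := v) hv T r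
  rw [← ha] at hnorm
  have hball : WithLp.toLp 2 a ∈ Metric.closedBall (0 : EuclideanSpace ℝ (Fin m)) (2 * R) := by
    rw [mem_closedBall_zero_iff]
    have := norm_le_norm_sub_add (WithLp.toLp 2 a) v
    linarith
  have hrisk := risk_le_of_mem_closure (Ψ := netFeature φ ω) hL hf
    (fun v => measurable_const.inner hψ) x hdev (hc hball)
  have hemp : ∑ j, L (f (x j)) (inner ℝ (WithLp.toLp 2 a) (netFeature φ ω (x j)))
      ≤ n * (ε / 4) := by
    refine (Finset.sum_le_card_nsmul _ _ (ε / 4) fun j _ => ?_).trans_eq (by simp)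
    rw [← networkOutput_eq_inner]
    exact (hL.le_abs_sub _ _).trans (hres j).le
  refine generalizationError_lt hL hf
    (measurable_networkOutput hφ measurable_const measurable_const measurable_id) hε ?_
  simp_rw [networkOutput_eq_inner]
  have hn0 : (0 : ℝ) < n := by exact_mod_cast hn
  -- The training residuals account for `ε / 4` and the deviation for `ε / 2`.
  have h3 : n * ∫ y, L (f y) (inner ℝ (WithLp.toLp 2 a) (netFeature φ ω y)) ∂D
      ≤ n * (3 / 4 * ε) := by linarith
  have := le_of_mul_le_mul_left h3 hn0
  linarith

end NetworkLearning

section NetworkSampleBound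

variable {d : ℕ} {b : ℕ → ℝ} (hb : SlowlyDecaying b) {B ε δ M c : ℝ} {L : ℝ → ℝ → ℝ}
  {f : UnitSphere d → ℝ} {D : Measure (UnitSphere d)} [IsProbabilityMeasure D]
  {W : Type w} [MeasurableSpace W] {ν : Measure W} [IsProbabilityMeasure ν]
  {φ : W → UnitSphere d → ℝ}

/-- Failure requires a bad hidden layer, badly fitted examples, or a large deviation. The first
vanishes as the width grows, the second as the training time grows, and the third has probability
below `δ` for an `n` that does not depend on the width. -/
theorem exists_sampleBound_sgdNetwork {θ : TensorSpace d} (hL : IsLoss B L) (hM : 0 ≤ M)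
    (hθ : ∀ x, inner ℝ θ (dotFeature hb x) = f x) (hnorm : ‖θ‖ ≤ √(c ^ 2 * M))
    (hφ : HasHiddenKernel ν φ (dotKernel b)) (hε : 0 < ε) (hδ : 0 < δ) (hδ1 : δ < 1) :
    ∃ m₀ : ℕ, ∀ m ≥ m₀, ∃ η₀ : ℝ, 0 < η₀ ∧ ∀ η : ℝ, 0 < η → η ≤ η₀ →
      ∃ T₀ : ℕ, ∀ T ≥ T₀,
        SampleBound (sgdNetwork ν φ m η T) L (sampleConst B (∑' k, b k) c) M f D ε δ := by
  have hκ := hb.tsum_pos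
  set κ := ∑' k, b k with hκdef
  have hΛ : 0 < Real.log δ⁻¹ := Real.log_pos ((one_lt_inv₀ hδ).2 hδ1)
  have hC := sampleConst_pos (B := B) (c := c) hκ
  have hfm : Measurable f := by
    simpa only [hθ] using measurable_inner_dotFeature hb θ
  rcases lt_or_ge (sampleConst B κ c * (M + Real.log δ⁻¹) / ε ^ 2) 1 with h1 | h1
  · refine ⟨0, fun m _ => ⟨1, one_pos, fun η _ _ => ⟨0, fun T _ => ?_⟩⟩⟩
    refine sampleBound_of_lt_one hL hε hδ (by positivity) (abs_le_of_represented hb hM hθ hnorm)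
      (mul_sqrt_lt hκ hε hM hΛ h1) fun data s => ?_
    change networkOutput φ s.1 (sgdWeights φ η data s.1 T s.2) = _
    rw [sgdWeights_zero_examples]
    ext x
    simp [networkOutput]
  set n := ⌊sampleConst B κ c * (M + Real.log δ⁻¹) / ε ^ 2⌋₊ with hn
  have hn1 : 1 ≤ n := (Nat.one_le_floor_iff _).2 h1
  set R := √(c ^ 2 * M + Real.log δ⁻¹) with hR
  -- The summand `log δ⁻¹ > 0` in `R` provides the strict slack that lets random features
  -- interpolate within norm `R`.
  have hθR : ‖θ‖ < R := hnorm.trans_lt (Real.sqrt_lt_sqrt (by positivity) (by linarith))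
  have hL' : IsLoss (|B| + 1) L := hL.mono (by linarith [le_abs_self B])
  set p₀ := Real.exp (-(2 * n * (ε / 4) ^ 2 / (|B| + 1) ^ 2)) with hp₀
  have hp₀δ : p₀ < δ := exp_neg_lt hκ hε hM hδ hδ1 h1 hn
  have hγ : 0 < ENNReal.ofReal ((δ - p₀) / 2) := ENNReal.ofReal_pos.2 (by linarith)
  have hbad := tendsto_measure_not_isGoodLayer (D := D) hφ (inner_dotFeature hb)
    (dotKernel_self b) hκ hfm hθ hθR n
    (fun x => (linearIndependent_dotFeature hb).comp _ Subtype.val_injective)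
  obtain ⟨m₀, hm₀⟩ := Filter.eventually_atTop.1 (hbad.eventually_lt_const hγ)
  -- On a good layer the squared features at the examples are at most `2 * κ`, so this step size
  -- satisfies the stability condition at each of them.
  refine ⟨m₀, fun m hm => ⟨(2 * κ)⁻¹, by positivity, fun η hη hη₀ => ?_⟩⟩
  have hηκ : η * (2 * κ) ≤ 1 := by
    refine (mul_le_mul_of_nonneg_right hη₀ (by positivity)).trans_eq ?_
    exact inv_mul_cancel₀ (by positivity)
  have hsgd := tendsto_measure_good_and_residual (D := D) (ν := ν) (m := m) (R := R) hφ.measurable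
    hfm hη hηκ (by positivity : 0 < ε / 4) n
  obtain ⟨T₀, hT₀⟩ := Filter.eventually_atTop.1 (hsgd.eventually_lt_const hγ)
  refine ⟨T₀, fun T hT => sampleBound_of_failureProb_lt (n := n) (Nat.floor_le (by positivity)) ?_⟩
  obtain ⟨A, hAR, hAc, hRA⟩ := (TopologicalSpace.IsSeparable.of_separableSpace
    (Metric.closedBall (0 : EuclideanSpace ℝ (Fin m)) (2 * R))).exists_countable_dense_subset
  have hdev := measure_prod_deviation_le (D := D) (ν := ν) (t := ε / 4) (κ := 2 * κ)
    hφ.measurable hL' (by positivity) hfm (by positivity) (by positivity) n hAc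
    (fun v hv => by simpa using hAR hv)
  set badSet := {z : (Fin n → UnitSphere d) × (Fin m → W) | ¬ IsGoodLayer φ D f κ R z.1 z.2}
    with hbadSet
  set devSet := {z : (Fin n → UnitSphere d) × (Fin m → W) |
      ∫⁻ y, ENNReal.ofReal (‖netFeature φ z.2 y‖ ^ 2) ∂D ≤ ENNReal.ofReal (2 * κ) ∧ ∃ v ∈ A,
        (∑ j, L (f (z.1 j)) (inner ℝ v (netFeature φ z.2 (z.1 j))))
          + (2 * (2 * R) * √(n * (2 * κ)) + n * (ε / 4))
          < n * ∫ y, L (f y) (inner ℝ v (netFeature φ z.2 y)) ∂D} with hdevSet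
  set sgdSet := {p : ((Fin n → UnitSphere d) × (Fin m → W)) × (Fin T → unitInterval) |
          IsGoodLayer φ D f κ R p.1.1 p.1.2 ∧ ∃ j, ε / 4 ≤ |networkOutput φ p.1.2
            (sgdWeights φ η (fun i => (p.1.1 i, f (p.1.1 i))) p.1.2 T p.2) (p.1.1 j)
              - f (p.1.1 j)|} with hsgdSet
  have hassoc := measurePreserving_prodAssoc (Measure.pi fun _ : Fin n => D)
    (Measure.pi fun _ : Fin m => ν) (Measure.pi fun _ : Fin T => (volume : Measure unitInterval))
  set μ := (Measure.pi fun _ : Fin n => D).prod (Measure.pi fun _ : Fin m => ν) with hμ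
  set τ := Measure.pi fun _ : Fin T => (volume : Measure unitInterval) with hτ
  calc failureProb (sgdNetwork ν φ m η T) L f D ε n
      = (μ.prod τ) (MeasurableEquiv.prodAssoc ⁻¹' {p : (Fin n → UnitSphere d) × (Fin m → W) ×
          (Fin T → unitInterval) | ¬ generalizationError L D f (networkOutput φ p.2.1
            (sgdWeights φ η (fun i => (p.1 i, f (p.1 i))) p.2.1 T p.2.2)) < ENNReal.ofReal ε}) := by
        rw [hassoc.measure_preimage_equiv]
        rfl
    _ ≤ (μ.prod τ) ((badSet ×ˢ Set.univ ∪ sgdSet) ∪ devSet ×ˢ Set.univ) := by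
        refine measure_mono fun p hp => ?_
        by_contra hnot
        simp only [Set.mem_union, Set.mem_prod, Set.mem_univ, and_true, not_or] at hnot
        obtain ⟨⟨hgood, hnsgd⟩, hndev⟩ := hnot
        have hgood' : IsGoodLayer φ D f κ R p.1.1 p.1.2 := not_not.1 hgood
        refine hp (generalizationError_sgd_lt hφ.measurable hL' hfm hη hηκ hε hn1
          (deviation_le hκ hε hM hΛ h1 hn) hgood' hRA ?_ ?_)
        · intro v hv
          by_contra hlt
          exact hndev ⟨hgood'.2.2, v, hv, not_le.1 hlt⟩
        · intro j
          by_contra hlt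
          exact hnsgd ⟨hgood', j, not_lt.1 hlt⟩
    _ ≤ (μ badSet + (μ.prod τ) sgdSet) + μ devSet := by
        refine (measure_union_le _ _).trans (add_le_add ((measure_union_le _ _).trans ?_) ?_)
        · rw [Measure.prod_prod, measure_univ, mul_one]
        · rw [Measure.prod_prod, measure_univ, mul_one]
    _ ≤ (μ badSet + (μ.prod τ) sgdSet) + ENNReal.ofReal p₀ := by gcongr
    _ < (ENNReal.ofReal ((δ - p₀) / 2) + ENNReal.ofReal ((δ - p₀) / 2)) + ENNReal.ofReal p₀ :=
        ENNReal.add_lt_add_right ENNReal.ofReal_ne_top (ENNReal.add_lt_add (hm₀ m hm) (hT₀ T hT))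
    _ = ENNReal.ofReal δ := by
        rw [← ENNReal.ofReal_add (by linarith) (by linarith),
          ← ENNReal.ofReal_add (by linarith) (Real.exp_pos _).le]
        congr 1
        ring

end NetworkSampleBound

/-! ### The product rule. -/

theorem mainTheorem3 (b : ℕ → ℝ) (hb : SlowlyDecaying b) (B : ℝ) :
    ∃ C : ℝ, 0 < C ∧
      ∀ (d : ℕ) (L : ℝ → ℝ → ℝ), IsLoss B L →
      ∀ (g h : UnitSphere d → ℝ) (P : MultiPowerSeries.{u} d) (Q : MultiPowerSeries.{v} d),
        P.Represents g → Q.Represents h →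
      ∀ M : ℝ,
        M = (P.tildeDeriv 1 * Q.tilde 1 + P.tilde 1 * Q.tildeDeriv 1
              + P.tilde 0 * Q.tilde 0) ^ 2 →
        -- learning with the kernel
        EfficientlyLearned (kernelLearner (dotKernel b)) L C M (fun x => g x * h x) ∧
        -- learning with sufficiently wide networks that have this kernel, trained by SGD
        ∀ (W : Type w) [MeasurableSpace W] (ν : Measure W) [IsProbabilityMeasure ν]
          (φ : W → UnitSphere d → ℝ), HasHiddenKernel ν φ (dotKernel b) →
        ∀ (D : Measure (UnitSphere d)) [IsProbabilityMeasure D] (ε δ : ℝ),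
          0 < ε → 0 < δ → δ < 1 →
          ∃ m₀ : ℕ, ∀ m ≥ m₀, ∃ η₀ : ℝ, 0 < η₀ ∧ ∀ η : ℝ, 0 < η → η ≤ η₀ →
            ∃ T₀ : ℕ, ∀ T ≥ T₀,
              SampleBound (sgdNetwork ν φ m η T) L C M (fun x => g x * h x) D ε δ := by
  obtain ⟨c, hc⟩ := hb.exists_inv_sqrt_le
  refine ⟨sampleConst B (∑' k, b k) c, sampleConst_pos hb.tsum_pos, ?_⟩
  intro d L hL g h P Q hP hQ M hM
  obtain ⟨θ, hθ, hnorm⟩ := hP.exists_vector_mul hQ hb hc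
  have hM0 : 0 ≤ M := hM ▸ sq_nonneg _
  have hnorm' : ‖θ‖ ≤ √(c ^ 2 * M) := by
    rw [hM, ← mul_pow]
    exact hnorm.trans (Real.le_sqrt_of_sq_le le_rfl)
  refine ⟨fun D _ ε δ hε hδ hδ1 => sampleBound_kernelLearner hb hL hM0 hθ hnorm' hε hδ hδ1, ?_⟩
  intro W _ ν _ φ hφ D _ ε δ hε hδ hδ1
  exact exists_sampleBound_sgdNetwork hb hL hM0 hθ hnorm' hφ hε hδ hδ1
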